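/- A semigroup $S$ is nilpotent of degree $3$ if $3$ is the least integer $r\ge 1$ such that the set $S^r=\{s_1s_2\cdots s_r : s_1,\dots,s_r\in S\}$ has exactly one element. For a partition $j$ of a non-negative integer $N$, written $j\vdash N$, let $j_i$ denote the number of summands of $j$ equal to $i$. For integers $1\le q<p$ put $$ \begin{aligned} K(p,q)=\sum_{j\vdash q-1}\ \sum_{k\vdash p-q}\Biggl[&\Bigl(\prod_{i=1}^{q-1}j_i!\,i^{j_i}\prod_{i=1}^{p-q}k_i!\,i^{k_i}\Bigr)^{-1} \prod_{a=1}^{\lfloor (p-q)/2\rfloor}\Bigl(1+\sum_{d\mid a}d\,j_d\Bigr)^{k_{2a}}\Bigl(1+\sum_{d\mid 2a}d\,j_d\Bigr)^{a\,k_{2a}}\\ &\cdot\prod_{a=1}^{\lfloor (p-q+1)/2\rfloor}\Bigl(1+\sum_{d\mid 2a-1}d\,j_d\Bigr)^{a\,k_{2a-1}} \cdot\prod_{a=1}^{p-q}\Bigl(1+\sum_{d\mid a}d\,j_d\Bigr)^{a\,k_a(k_a-1)/2}\\ &\cdot\prod_{1\le a<b\le p-q}\Bigl(1+\sum_{d\mid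 \operatorname{lcm}(a,b)}d\,j_d\Bigr)^{k_ak_b\gcd(a,b)}\Biggr]. \end{aligned} $$ Then for every $n\in\mathbb{N}$ the number of commutative nilpotent semigroups of degree $3$ and order $n$, up to isomorphism, equals $$ \sum_{m=2}^{c(n)}\bigl(K(n,m)-K(n-1,m-1)\bigr),\qquad c(n)=\Bigl\lfloor n+\tfrac32-\sqrt{2n+\tfrac14}\,\Bigr\rfloor , $$ where an empty sum is $0$. -/

import Mathlib

namespace CommNilpotentCount

/-- `powerSet S r` is the set `S ^ r = {s₁ * s₂ * ⋯ * sᵣ | s₁, …, sᵣ ∈ S}` of all products of `r`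
elements of the semigroup `S`, for `r ≥ 1`. A semigroup need not have an empty product, and the
value at `r = 0` is never used. -/
def powerSet (S : Type*) [Semigroup S] : ℕ → Set S
  | 0 => ∅
  | 1 => Set.univ
  | r + 2 => {x | ∃ y ∈ powerSet S (r + 1), ∃ s : S, x = y * s}

/-- `S` is nilpotent of (nilpotency) degree `r`: `r` is the least positive integer such that
`S ^ r` has exactly one element. -/
def IsNilpotentOfDegree (S : Type*) [Semigroup S] (r : ℕ) : Prop :=
  IsLeast {t : ℕ | 1 ≤ t ∧ (powerSet S t).ncard = 1} r

/-- The commutative nilpotent semigroups of degree `3` on a fixed set with `n` elements. -/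
def CommNil3 (n : ℕ) : Type :=
  {S : CommSemigroup (Fin n) // @IsNilpotentOfDegree (Fin n) S.toSemigroup 3}

/-- Isomorphism of semigroups, as an equivalence relation on `CommNil3 n`. -/
def isoSetoid (n : ℕ) : Setoid (CommNil3 n) where
  r S T := ∃ f : Equiv.Perm (Fin n), ∀ x y : Fin n, f (S.1.mul x y) = T.1.mul (f x) (f y)
  iseqv :=
    { refl := fun _ => ⟨Equiv.refl _, fun _ _ => rfl⟩
      symm := by
        rintro S T ⟨f, hf⟩
        refine ⟨f.symm, fun x y => ?_⟩
        rw [Equiv.symm_apply_eq, hf, Equiv.apply_symm_apply, Equiv.apply_symm_apply]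
      trans := by
        rintro S T U ⟨f, hf⟩ ⟨g, hg⟩
        refine ⟨f.trans g, fun x y => ?_⟩
        simp only [Equiv.trans_apply, hf, hg] }

/-- The number of commutative nilpotent semigroups of degree `3` and order `n` up to
isomorphism. -/
noncomputable def numCommNil3 (n : ℕ) : ℕ :=
  Nat.card (Quotient (isoSetoid n))

/-- For a partition `j` of `n`, the number `j_i` of summands equal to `i`. -/
def mult {n : ℕ} (j : Nat.Partition n) (i : ℕ) : ℕ := j.parts.count i

/-- For a partition `j` of `n`, the number `∏_{i=1}^{n} j_i! * i ^ j_i`. -/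
def symmFactor {n : ℕ} (j : Nat.Partition n) : ℕ :=
  ∏ i ∈ Finset.Icc 1 n, (mult j i).factorial * i ^ mult j i

/-- For a partition `j`, the number `1 + ∑_{d ∣ i} d * j_d`. -/
def fixCount {n : ℕ} (j : Nat.Partition n) (i : ℕ) : ℕ :=
  1 + ∑ d ∈ i.divisors, d * mult j d

/-- The number `K(p, q)`, for `1 ≤ q < p`. The last four factors are, in this order, the
contributions to the cycle index of the symmetric group acting on the subsets of size `1` or `2` of:
single cycles of even length `2a`; single cycles of odd length `2a - 1`; pairs of distinct
cycles of the same length `a`; pairs of cycles of different lengths `a < b`. -/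
def K (p q : ℕ) : ℚ :=
  ∑ j : Nat.Partition (q - 1), ∑ k : Nat.Partition (p - q),
    ((symmFactor j * symmFactor k : ℕ) : ℚ)⁻¹ *
      (((∏ a ∈ Finset.Icc 1 ((p - q) / 2),
            fixCount j a ^ mult k (2 * a) * fixCount j (2 * a) ^ (a * mult k (2 * a))) *
        (∏ a ∈ Finset.Icc 1 ((p - q + 1) / 2),
            fixCount j (2 * a - 1) ^ (a * mult k (2 * a - 1))) *
        (∏ a ∈ Finset.Icc 1 (p - q), fixCount j a ^ (a * (mult k a).choose 2)) *
        (∏ b ∈ Finset.Icc 1 (p - q), ∏ a ∈ Finset.Ico 1 b,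
            fixCount j (Nat.lcm a b) ^ (mult k a * mult k b * Nat.gcd a b)) : ℕ) : ℚ)

/-- `c(n) = ⌊n + 3/2 - √(2n + 1/4)⌋`; the number inside the floor is never negative. -/
noncomputable def c (n : ℕ) : ℕ :=
  ⌊(n : ℝ) + 3 / 2 - Real.sqrt (2 * (n : ℝ) + 1 / 4)⌋₊

end CommNilpotentCount

/-! Let `S` be commutative with all triple products equal to `z`, let `P` be its set of products and
`m` the size of `P`. Then `z ∈ P`, and any product with a factor in `P` is `z`. So `S` amounts to a
map from the unordered pairs (repetition allowed) of the `n - m` elements outside `P` to `P`,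
pointed at `z`, that hits every other point of `P`. Conversely every such map with `m ≥ 2` gives a
semigroup of degree 3, and isomorphism means permuting the generators and the nonzero points of `P`
(`card_squareCard_eq`).

Orbits of maps that miss a nonzero point correspond to orbits of maps into a target with one point
fewer (`card_isFullOrbit_add`). The full orbits are therefore counted by a difference of two orbit
counts with the same generators, which is `K n m - K (n - 1) (m - 1)`.

That `K` counts orbits is Burnside's lemma. A map fixed by `(σ, τ)` is equivariant; on each cycle of
`σ` on pairs, of length `l` say, it is given by one point fixed by the `l`-th power of `τ`. To
multiply over these cycles without listing them, logarithms are taken: a sum over cycles is a sum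
over points with weight one over the period, and the period of a pair is known from its two members
(`sum_log_sym2`).

Finally, a full map needs `m - 1` to be at most the number of pairs, which is exactly `m ≤ c n`
(`le_c_iff`), so the omitted terms vanish. -/

namespace CommNilpotentCount

open Function Finset

/-! ### Cycle structure of a permutation, read off from minimal periods. -/

section Period

theorem minimalPeriod_perm_pos {α : Type*} [Finite α] (g : Equiv.Perm α) (x : α) : 0 < minimalPeriod g x :=
  minimalPeriod_pos_of_mem_periodicPts (g.injective.mem_periodicPts x)

theorem iterate_injOn_range_minimalPeriod {α : Type*} (g : Equiv.Perm α) (x : α) :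
    Set.InjOn (fun k => g^[k] x) (range (minimalPeriod g x) : Set ℕ) := by
  rw [coe_range]
  exact iterate_injOn_Iio_minimalPeriod

theorem minimalPeriod_mem_Icc {α : Type*} [Fintype α] (g : Equiv.Perm α) (x : α) :
    minimalPeriod g x ∈ Icc 1 (Fintype.card α) := by
  rw [mem_Icc]
  exact ⟨minimalPeriod_perm_pos g x, minimalPeriod_le_card⟩

variable {α : Type*} [Fintype α] [DecidableEq α]

theorem minimalPeriod_eq_of_sameCycle {g : Equiv.Perm α} {x y : α} (h : g.SameCycle x y) :
    minimalPeriod g y = minimalPeriod g x := by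
  obtain ⟨i, -, -, rfl⟩ := h.exists_pow_eq
  rw [← Equiv.Perm.iterate_eq_pow]
  exact minimalPeriod_apply_iterate (g.injective.mem_periodicPts x) i

theorem filter_sameCycle_eq_image (g : Equiv.Perm α) (x : α) :
    univ.filter (g.SameCycle x) = (range (minimalPeriod g x)).image (fun k => g^[k] x) := by
  ext y
  simp only [mem_filter, mem_univ, true_and, mem_image, mem_range]
  constructor
  · intro h
    obtain ⟨i, -, -, rfl⟩ := h.exists_pow_eq
    refine ⟨i % minimalPeriod g x, Nat.mod_lt _ (minimalPeriod_perm_pos g x), ?_⟩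
    rw [iterate_mod_minimalPeriod_eq, Equiv.Perm.iterate_eq_pow]
  · rintro ⟨k, -, rfl⟩
    exact ⟨k, by rw [Equiv.Perm.iterate_eq_pow]; simp⟩

theorem card_filter_sameCycle (g : Equiv.Perm α) (x : α) :
    (univ.filter (g.SameCycle x)).card = minimalPeriod g x := by
  rw [filter_sameCycle_eq_image, card_image_of_injOn (iterate_injOn_range_minimalPeriod g x),
    card_range]

theorem card_support_cycleOf {g : Equiv.Perm α} {x : α} (hx : g x ≠ x) :
    (g.cycleOf x).support.card = minimalPeriod g x := by
  rw [← card_filter_sameCycle]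
  congr 1
  ext y
  simp [Equiv.Perm.mem_support_cycleOf_iff' hx]

theorem card_filter_minimalPeriod_of_two_le (g : Equiv.Perm α) {l : ℕ} (hl : 2 ≤ l) :
    (univ.filter fun x => minimalPeriod g x = l).card = l * g.cycleType.count l := by
  have h1 : (univ.filter fun x => minimalPeriod g x = l) =
      (g.cycleFactorsFinset.filter fun c => c.support.card = l).biUnion fun c => c.support := by
    ext x
    simp only [mem_filter, mem_univ, true_and, mem_biUnion]
    constructor
    · intro h
      have hx : g x ≠ x := fun h' => by
        have : minimalPeriod g x = 1 := minimalPeriod_eq_one_iff_isFixedPt.2 h'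
        omega
      refine ⟨g.cycleOf x, ⟨?_, (card_support_cycleOf hx).trans h⟩, ?_⟩
      · rw [Equiv.Perm.cycleOf_mem_cycleFactorsFinset_iff]
        exact Equiv.Perm.mem_support.2 hx
      · rw [Equiv.Perm.mem_support_cycleOf_iff' hx]
    · rintro ⟨c, ⟨hc, hcl⟩, hx⟩
      have hgx : g x ≠ x :=
        Equiv.Perm.mem_support.1 (Equiv.Perm.mem_cycleFactorsFinset_support_le hc hx)
      rw [← card_support_cycleOf hgx, ← Equiv.Perm.cycle_is_cycleOf hx hc, hcl]
  rw [h1, card_biUnion]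
  · rw [sum_congr rfl (g := fun _ => l) (fun c hc => (mem_filter.1 hc).2), sum_const, smul_eq_mul,
      mul_comm, Equiv.Perm.cycleType_def, Multiset.count_map]
    congr 1
    rw [Finset.card_def, Finset.filter_val]
    congr 1
    exact Multiset.filter_congr fun c _ => by simp [eq_comm]
  · intro c hc d hd hcd
    exact (g.cycleFactorsFinset_pairwise_disjoint (mem_filter.1 hc).1
      (mem_filter.1 hd).1 hcd).disjoint_support

/-- A permutation with `k` cycles of length `l` has `l * k` points of minimal period `l`. -/
theorem card_filter_minimalPeriod (g : Equiv.Perm α) (l : ℕ) :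
    (univ.filter fun x => minimalPeriod g x = l).card = l * mult g.partition l := by
  rcases Nat.lt_or_ge l 2 with hl | hl
  -- `cycleType` ignores fixed points, so length 1 is counted by the complement of the support.
  · have h0 : ¬ (1 ∈ g.cycleType) := fun h =>
      absurd (Equiv.Perm.two_le_of_mem_cycleType h) (by norm_num)
    obtain rfl | rfl : l = 0 ∨ l = 1 := by omega
    · rw [zero_mul, card_eq_zero, filter_eq_empty_iff]
      intro x _ h
      exact (minimalPeriod_perm_pos g x).ne' h
    · have h1 : (univ.filter fun x => minimalPeriod g x = 1) = g.supportᶜ := by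
        ext x
        simp [minimalPeriod_eq_one_iff_isFixedPt, IsFixedPt]
      rw [h1, card_compl, mult, Equiv.Perm.parts_partition, Multiset.count_add,
        Multiset.count_replicate_self, Multiset.count_eq_zero_of_notMem h0]
      simp
  · rw [card_filter_minimalPeriod_of_two_le g hl, mult, Equiv.Perm.parts_partition,
      Multiset.count_add, Multiset.count_eq_zero_of_notMem (s := Multiset.replicate _ _), add_zero]
    intro h
    have := Multiset.eq_of_mem_replicate h
    omega

theorem sum_minimalPeriod (g : Equiv.Perm α) (φ : ℕ → ℝ) :
    ∑ x, φ (minimalPeriod g x) =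
      ∑ l ∈ Icc 1 (Fintype.card α), (l : ℝ) * mult g.partition l * φ l := by
  rw [← sum_fiberwise_of_maps_to (fun x _ => minimalPeriod_mem_Icc g x)]
  refine sum_congr rfl fun l _ => ?_
  rw [sum_congr rfl (g := fun _ => φ l) (fun x hx => by rw [(mem_filter.1 hx).2]), sum_const,
    card_filter_minimalPeriod, nsmul_eq_mul]
  push_cast
  ring

/-- The points of `Option α` fixed by the `m`-th power of a permutation of `α`. -/
theorem card_filter_iterate_optionCongr (g : Equiv.Perm α) {m : ℕ} (hm : 0 < m) :
    (univ.filter fun y : Option α => (Equiv.optionCongr g)^[m] y = y).card =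
      fixCount g.partition m := by
  have hmap : ∀ (k : ℕ) (y : Option α), (Equiv.optionCongr g)^[k] y = y.map g^[k] := by
    intro k
    induction k with
    | zero => simp
    | succ k ih =>
      intro y
      rw [iterate_succ_apply', ih]
      cases y
      · rfl
      · simp only [Equiv.optionCongr_apply, Option.map_some, iterate_succ_apply']
  have h1 : (univ.filter fun y : Option α => (Equiv.optionCongr g)^[m] y = y) =
      (univ.filter fun x => minimalPeriod g x ∣ m).insertNone := by
    ext y
    cases y with
    | none => simp [hmap]
    | some x =>
      simp only [mem_filter, mem_univ, true_and, hmap, Option.map_some, Option.some.injEq,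
        Finset.some_mem_insertNone]
      exact isPeriodicPt_iff_minimalPeriod_dvd
  rw [h1, card_insertNone, fixCount, add_comm]
  congr 1
  rw [card_eq_sum_card_fiberwise (f := fun x => minimalPeriod g x) (t := m.divisors)]
  · refine sum_congr rfl fun d hd => ?_
    rw [← card_filter_minimalPeriod, filter_filter]
    congr 1
    ext x
    simp only [mem_filter, mem_univ, true_and, and_iff_right_iff_imp]
    rintro rfl
    exact Nat.dvd_of_mem_divisors hd
  · intro x hx
    simp only [coe_filter, mem_univ, true_and, Set.mem_ofPred_eq] at hx
    exact_mod_cast Nat.mem_divisors.2 ⟨hx, hm.ne'⟩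

/-- The number of permutations with a given cycle structure. -/
theorem card_partition_eq_mul_symmFactor (j : Nat.Partition (Fintype.card α)) :
    (univ.filter fun g : Equiv.Perm α => g.partition = j).card * symmFactor j =
      (Fintype.card α).factorial := by
  -- The known count is by cycle type, so the parts equal to 1 are split off and restored
  -- afterwards.
  set m := j.parts.filter (fun n => 2 ≤ n) with hm
  have hparts : j.parts = m + Multiset.replicate (mult j 1) 1 := by
    rw [mult, ← Multiset.filter_eq', hm]
    conv_lhs => rw [← Multiset.filter_add_not (fun n => 2 ≤ n) j.parts]
    congr 1
    refine Multiset.filter_congr fun x hx => ?_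
    have := j.parts_pos hx
    omega
  have hsum : m.sum + mult j 1 = Fintype.card α := by
    conv_rhs => rw [← j.parts_sum, hparts]
    simp
  have h1 : (univ.filter fun g : Equiv.Perm α => g.partition = j) =
      univ.filter fun g : Equiv.Perm α => g.cycleType = m := by
    ext g
    simp only [mem_filter, mem_univ, true_and]
    constructor
    · rintro rfl
      rw [hm, Equiv.Perm.filter_parts_partition_eq_cycleType]
    · intro h
      rw [Nat.Partition.ext_iff, Equiv.Perm.parts_partition, h, hparts, ← Equiv.Perm.sum_cycleType,
        h]
      congr 2
      omega
  have h2 := Equiv.Perm.card_of_cycleType_mul_eq α m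
  rw [if_pos ⟨by omega, fun a ha => (Multiset.mem_filter.1 ha).2⟩] at h2
  rw [h1, ← h2]
  congr 1
  have hsub : m.toFinset ⊆ Icc 2 (Fintype.card α) := by
    intro a ha
    rw [Multiset.mem_toFinset] at ha
    rw [mem_Icc]
    refine ⟨(Multiset.mem_filter.1 ha).2, ?_⟩
    have := Multiset.le_sum_of_mem ha
    omega
  -- For empty `α` the interval from 1 is empty, so there is no factor at 1 to split off; the value
  -- used there is `0! * 1 ^ 0 = 1`.
  have hone : ∀ f : ℕ → ℕ, f 1 * ∏ i ∈ Icc 2 (Fintype.card α), f i =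
      if Fintype.card α = 0 then f 1 else ∏ i ∈ Icc 1 (Fintype.card α), f i := by
    intro f
    split_ifs with h
    · simp [h]
    · rw [← Finset.insert_Icc_add_one_left_eq_Icc (by omega : 1 ≤ Fintype.card α),
        prod_insert (by simp)]
      rfl
  have hcount : ∀ i ∈ Icc 2 (Fintype.card α), m.count i = mult j i := by
    intro i hi
    rw [hm, Multiset.count_filter_of_pos (mem_Icc.1 hi).1, mult]
  have hfull : symmFactor j = (mult j 1).factorial * 1 ^ mult j 1 *
      ∏ i ∈ Icc 2 (Fintype.card α), (mult j i).factorial * i ^ mult j i := by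
    rw [hone (fun i => (mult j i).factorial * i ^ mult j i), symmFactor]
    split_ifs with h
    · have : mult j 1 = 0 := by omega
      simp [h, this]
    · rfl
  rw [hfull, prod_mul_distrib, prod_multiset_count_of_subset m _ hsub,
    prod_subset hsub (f := fun n => (m.count n).factorial)]
  · rw [prod_congr rfl fun i hi => congrArg Nat.factorial (hcount i hi),
      prod_congr rfl fun i hi => congrArg (i ^ ·) (hcount i hi),
      show Fintype.card α - m.sum = mult j 1 by omega]
    ring
  · intro i _ hi
    rw [Multiset.mem_toFinset] at hi
    simp [Multiset.count_eq_zero_of_notMem hi]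

end Period

/-! ### Counting equivariant maps cycle by cycle. -/

section Equivariant

theorem sameCycle_out {X : Type*} (g : Equiv.Perm X) (x : X) :
    g.SameCycle (Quotient.mk (Equiv.Perm.SameCycle.setoid g) x).out x :=
  Quotient.exact (Quotient.out_eq (Quotient.mk (Equiv.Perm.SameCycle.setoid g) x))

theorem iterate_eq_iterate_of_modEq {Y : Type*} {h : Y → Y} {y : Y} {p k l : ℕ}
    (hy : h^[p] y = y) (hkl : k ≡ l [MOD p]) : h^[k] y = h^[l] y := by
  have hp : IsPeriodicPt h p y := hy
  rw [← hp.iterate_mod_apply k, ← hp.iterate_mod_apply l, hkl]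

variable {X : Type*} [Fintype X] [DecidableEq X]

-- A cycle of length `l` has `l` points, each carrying the share `1 / l`. This trades the choice of
-- representatives for a sum over points.
open Classical in
theorem sum_quotient_sameCycle (g : Equiv.Perm X) (φ : ℕ → ℝ) :
    ∑ q : Quotient (Equiv.Perm.SameCycle.setoid g), φ (minimalPeriod g q.out) =
      ∑ x, φ (minimalPeriod g x) / minimalPeriod g x := by
  rw [← sum_fiberwise (s := univ) (g := fun x => Quotient.mk (Equiv.Perm.SameCycle.setoid g) x)]
  refine sum_congr rfl fun q _ => ?_
  have h1 : (univ.filter fun x => Quotient.mk (Equiv.Perm.SameCycle.setoid g) x = q) =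
      univ.filter (g.SameCycle q.out) := by
    ext x
    simp only [mem_filter, mem_univ, true_and]
    constructor
    · rintro rfl
      exact sameCycle_out g x
    · intro h
      conv_rhs => rw [← q.out_eq]
      exact (Quotient.sound h).symm
  have h2 : ∀ x ∈ univ.filter (g.SameCycle q.out),
      φ (minimalPeriod g x) / minimalPeriod g x =
        φ (minimalPeriod g q.out) / minimalPeriod g q.out := by
    intro x hx
    rw [minimalPeriod_eq_of_sameCycle (mem_filter.1 hx).2]
  have h3 : (minimalPeriod g q.out : ℝ) ≠ 0 := by
    exact_mod_cast (minimalPeriod_perm_pos g q.out).ne'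
  rw [h1, sum_congr rfl h2, sum_const, card_filter_sameCycle, nsmul_eq_mul]
  field_simp

/-- The equivariant maps between two sets with a permutation are determined by their values on
representatives of the cycles. -/
noncomputable def equivariantEquiv {Y : Type*} (g : Equiv.Perm X) (h : Y → Y) :
    {f : X → Y // ∀ x, f (g x) = h (f x)} ≃
      ((q : Quotient (Equiv.Perm.SameCycle.setoid g)) →
        {y : Y // h^[minimalPeriod g q.out] y = y}) := by
  -- `e x` will be a number of steps from the chosen representative of the cycle to `x`; it matters
  -- only modulo the period.
  have hex : ∀ x, ∃ k : ℕ, g^[k] (Quotient.mk (Equiv.Perm.SameCycle.setoid g) x).out = x := by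
    intro x
    obtain ⟨k, -, -, hk⟩ := (sameCycle_out g x).exists_pow_eq
    exact ⟨k, by rw [Equiv.Perm.iterate_eq_pow, hk]⟩
  choose e he using hex
  have hiter : ∀ f : X → Y, (∀ x, f (g x) = h (f x)) → ∀ k x, f (g^[k] x) = h^[k] (f x) := by
    intro f hf k x
    exact (Function.Semiconj.iterate_right (f := f) (ga := g) (gb := h) hf k) x
  refine
    { toFun := fun f q => ⟨f.1 q.out, ?_⟩
      invFun := fun F => ⟨fun x => h^[e x] (F (Quotient.mk _ x)).1, ?_⟩
      left_inv := ?_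
      right_inv := ?_ }
  · rw [← hiter f.1 f.2, iterate_minimalPeriod]
  · intro x
    have hq : Quotient.mk (Equiv.Perm.SameCycle.setoid g) (g x) =
        Quotient.mk (Equiv.Perm.SameCycle.setoid g) x :=
      Quotient.sound (Equiv.Perm.sameCycle_apply_left.2 (Equiv.Perm.SameCycle.refl g x))
    have h2 := he (g x)
    rw [hq] at h2
    change h^[e (g x)] (F (Quotient.mk _ (g x))).1 = h (h^[e x] (F (Quotient.mk _ x)).1)
    rw [hq, ← iterate_succ_apply' h]
    refine iterate_eq_iterate_of_modEq (F (Quotient.mk _ x)).2 ?_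
    have h3 : g^[e (g x)] (Quotient.mk (Equiv.Perm.SameCycle.setoid g) x).out =
        g^[e x + 1] (Quotient.mk (Equiv.Perm.SameCycle.setoid g) x).out := by
      rw [h2, iterate_succ_apply', he]
    rw [← iterate_mod_minimalPeriod_eq (n := e (g x)),
      ← iterate_mod_minimalPeriod_eq (n := e x + 1)] at h3
    exact iterate_injOn_range_minimalPeriod g _
      (by simpa using Nat.mod_lt _ (minimalPeriod_perm_pos g _))
      (by simpa using Nat.mod_lt _ (minimalPeriod_perm_pos g _)) h3
  · rintro ⟨f, hf⟩
    ext x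
    simp only
    rw [← hiter f hf, he]
  · intro F
    ext q
    change h^[e q.out] (F (Quotient.mk _ q.out)).1 = (F q).1
    have hq : Quotient.mk (Equiv.Perm.SameCycle.setoid g) q.out = q := q.out_eq
    rw [hq]
    have h2 := he q.out
    rw [hq] at h2
    have h4 : minimalPeriod g q.out ∣ e q.out := isPeriodicPt_iff_minimalPeriod_dvd.1 h2
    exact iterate_eq_iterate_of_modEq (F q).2 (l := 0) (Nat.modEq_zero_iff_dvd.2 h4)

/-- The number of equivariant maps, in terms of the minimal periods of the points. -/
theorem log_card_equivariant {Y : Type*} [Fintype Y] [DecidableEq Y] (g : Equiv.Perm X)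
    (h : Y → Y) (F : ℕ → ℕ) (hF : ∀ m, 0 < m → (univ.filter fun y => h^[m] y = y).card = F m)
    (hpos : ∀ m, 0 < m → 0 < F m) :
    Nat.card {f : X → Y // ∀ x, f (g x) = h (f x)} ≠ 0 ∧
      Real.log (Nat.card {f : X → Y // ∀ x, f (g x) = h (f x)}) =
        ∑ x, Real.log (F (minimalPeriod g x)) / minimalPeriod g x := by
  classical
  have h1 : Nat.card {f : X → Y // ∀ x, f (g x) = h (f x)} =
      ∏ q : Quotient (Equiv.Perm.SameCycle.setoid g), F (minimalPeriod g q.out) := by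
    rw [Nat.card_congr (equivariantEquiv g h), Nat.card_pi]
    refine prod_congr rfl fun q _ => ?_
    rw [← hF _ (minimalPeriod_perm_pos g _), Nat.card_eq_fintype_card, Fintype.card_subtype]
  have h2 : ∀ q : Quotient (Equiv.Perm.SameCycle.setoid g), F (minimalPeriod g q.out) ≠ 0 :=
    fun q => (hpos _ (minimalPeriod_perm_pos g _)).ne'
  rw [h1]
  refine ⟨prod_ne_zero_iff.2 fun q _ => h2 q, ?_⟩
  rw [← sum_quotient_sameCycle g fun m => Real.log (F m)]
  push_cast
  exact Real.log_prod fun q _ => by exact_mod_cast h2 q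

end Equivariant

/-! ### Periods of unordered pairs. -/

section SymmetricSquare

variable {α : Type*}

/-- The permutation of the unordered pairs induced by a permutation. -/
def sym2Perm (g : Equiv.Perm α) : Equiv.Perm (Sym2 α) where
  toFun := Sym2.map g
  invFun := Sym2.map g.symm
  left_inv z := by simp [Sym2.map_map]
  right_inv z := by simp [Sym2.map_map]

@[simp]
theorem sym2Perm_mk (g : Equiv.Perm α) (x y : α) : sym2Perm g s(x, y) = s(g x, g y) := rfl

theorem iterate_sym2Perm_mk (g : Equiv.Perm α) (k : ℕ) (x y : α) :
    (sym2Perm g)^[k] s(x, y) = s(g^[k] x, g^[k] y) := by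
  induction k generalizing x y with
  | zero => rfl
  | succ k ih => rw [iterate_succ_apply, sym2Perm_mk, ih, iterate_succ_apply, iterate_succ_apply]

/-- No power of `g` takes `x` to `y`, so the pair never returns swapped and behaves like the ordered
pair. -/
theorem minimalPeriod_sym2_of_not_sameCycle {g : Equiv.Perm α} {x y : α}
    (h : ¬ g.SameCycle x y) :
    minimalPeriod (sym2Perm g) s(x, y) = (minimalPeriod g x).lcm (minimalPeriod g y) := by
  rw [← minimalPeriod_prodMap g g (x, y), minimalPeriod_eq_minimalPeriod_iff]
  intro k
  have h1 : ∀ k, g^[k] x ≠ y := by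
    intro k hk
    refine h ⟨k, ?_⟩
    rw [zpow_natCast, ← Equiv.Perm.iterate_eq_pow, hk]
  simp [IsPeriodicPt, IsFixedPt, iterate_sym2Perm_mk, Prod.map_iterate, h1]

/-- A return in swapped order after `m` steps needs `m ≡ k` and `m ≡ -k` modulo the cycle length
`l`, hence `l ∣ 2 * k`. Apart from `k = 0`, only antipodal pairs do this, and they return after half
the cycle. -/
theorem minimalPeriod_sym2_iterate [Finite α] (g : Equiv.Perm α) (x : α) {k : ℕ}
    (hk : k < minimalPeriod g x) :
    minimalPeriod (sym2Perm g) s(x, g^[k] x) =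
      if 2 * k = minimalPeriod g x then k else minimalPeriod g x := by
  set l := minimalPeriod g x with hl
  have hper : ∀ m, g^[m] x = x ↔ l ∣ m := fun m => isPeriodicPt_iff_minimalPeriod_dvd
  have hmod : ∀ m n, g^[m] x = g^[n] x ↔ m % l = n % l := by
    intro m n
    constructor
    · intro h
      rw [← iterate_mod_minimalPeriod_eq (n := m), ← iterate_mod_minimalPeriod_eq (n := n)] at h
      exact iterate_injOn_range_minimalPeriod g _
        (by simpa using Nat.mod_lt _ (minimalPeriod_perm_pos g _))
        (by simpa using Nat.mod_lt _ (minimalPeriod_perm_pos g _)) h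
    · intro h
      rw [← iterate_mod_minimalPeriod_eq (n := m), ← iterate_mod_minimalPeriod_eq (n := n), ← hl, h]
  have hdvd : ∀ m, minimalPeriod (sym2Perm g) s(x, g^[k] x) ∣ m ↔
      (l ∣ m ∨ (m % l = k % l ∧ l ∣ m + k)) := by
    intro m
    rw [← isPeriodicPt_iff_minimalPeriod_dvd, IsPeriodicPt, IsFixedPt, iterate_sym2Perm_mk,
      Sym2.eq_iff, ← iterate_add_apply, hmod, hper, hper, hmod]
    constructor
    · rintro (⟨h, -⟩ | h)
      exacts [Or.inl h, Or.inr h]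
    · rintro (h | h)
      · refine Or.inl ⟨h, ?_⟩
        obtain ⟨c, rfl⟩ := h
        simp
      · exact Or.inr h
  have hlpos : 0 < l := minimalPeriod_perm_pos g x
  refine Nat.dvd_right_iff_eq.1 fun m => ?_
  rw [hdvd]
  split_ifs with h2
  · rw [← h2]
    constructor
    · rintro (h | ⟨h, h'⟩)
      · exact (Dvd.intro_left 2 rfl).trans h
      · exact (Nat.dvd_add_left dvd_rfl).1 ((Dvd.intro_left 2 rfl).trans h')
    · rintro ⟨c, rfl⟩
      rcases Nat.even_or_odd' c with ⟨d, rfl | rfl⟩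
      · exact Or.inl ⟨d, by ring⟩
      · refine Or.inr ⟨?_, ⟨d + 1, by ring⟩⟩
        rw [show k * (2 * d + 1) = k + (2 * k) * d by ring, Nat.add_mul_mod_self_left]
  · constructor
    · rintro (h | ⟨h, h'⟩)
      · exact h
      · rw [Nat.mod_eq_of_lt hk] at h
        have h3 : l ∣ k + k := by
          rw [Nat.dvd_iff_mod_eq_zero] at h' ⊢
          rw [Nat.add_mod, h] at h'
          rw [Nat.add_mod, Nat.mod_eq_of_lt hk]
          rwa [Nat.mod_eq_of_lt hk] at h'
        obtain ⟨c, hc⟩ := h3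
        have hc2 : c < 2 := by
          by_contra hcon
          have : l * 2 ≤ l * c := Nat.mul_le_mul_left _ (by omega)
          omega
        obtain rfl | rfl : c = 0 ∨ c = 1 := by omega
        · have : k = 0 := by omega
          rw [this] at h
          exact Nat.dvd_of_mod_eq_zero h
        · omega
    · exact Or.inl

variable [Fintype α] [DecidableEq α]

/-- An off-diagonal pair comes from two ordered pairs; a diagonal one comes from one ordered pair
and once more from the diagonal sum. -/
theorem sum_sym2 (ψ : Sym2 α → ℝ) :
    ∑ z, ψ z = ((∑ x, ∑ y, ψ s(x, y)) + ∑ x, ψ s(x, x)) / 2 := by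
  have h1 : ∑ x, ∑ y, ψ s(x, y) =
      ∑ z : Sym2 α, ((univ.filter fun p : α × α => s(p.1, p.2) = z).card : ℝ) * ψ z := by
    rw [← Fintype.sum_prod_type' (fun x y => ψ s(x, y)),
      ← sum_fiberwise (s := univ) (g := fun p : α × α => s(p.1, p.2))]
    refine sum_congr rfl fun z _ => ?_
    rw [sum_congr rfl (g := fun _ => ψ z) (fun p hp => by rw [(mem_filter.1 hp).2]), sum_const,
      nsmul_eq_mul]
  have h2 : ∑ x, ψ s(x, x) =
      ∑ z : Sym2 α, ((univ.filter fun x : α => s(x, x) = z).card : ℝ) * ψ z := by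
    rw [← sum_fiberwise (s := univ) (g := fun x : α => s(x, x))]
    refine sum_congr rfl fun z _ => ?_
    rw [sum_congr rfl (g := fun _ => ψ z) (fun p hp => by rw [(mem_filter.1 hp).2]), sum_const,
      nsmul_eq_mul]
  rw [h1, h2, ← sum_add_distrib, sum_div]
  refine sum_congr rfl fun z _ => ?_
  rw [← add_mul]
  have h3 : (univ.filter fun p : α × α => s(p.1, p.2) = z).card +
      (univ.filter fun x : α => s(x, x) = z).card = 2 := by
    induction z with | _ a b
    have h4 : (univ.filter fun p : α × α => s(p.1, p.2) = s(a, b)) = {(a, b), (b, a)} := by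
      ext ⟨p, q⟩
      simp
    rw [h4]
    by_cases hab : a = b
    · subst hab
      have h5 : (univ.filter fun x : α => s(x, x) = s(a, a)) = {a} := by
        ext x
        simp
      rw [h5, pair_eq_singleton, card_singleton, card_singleton]
    · have h5 : (univ.filter fun x : α => s(x, x) = s(a, b)) = ∅ := by
        ext x
        simp only [Sym2.eq_iff, mem_filter, mem_univ, true_and, notMem_empty, iff_false]
        rintro (⟨rfl, h⟩ | ⟨rfl, h⟩)
        exacts [hab h, hab h.symm]
      rw [h5, card_pair (by simp [Ne, hab])]
      simp
  have h4 : ((univ.filter fun p : α × α => s(p.1, p.2) = z).card : ℝ) +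
      (univ.filter fun x : α => s(x, x) = z).card = 2 := by exact_mod_cast h3
  rw [h4]
  ring

end SymmetricSquare

/-! ### Sums over pairs in terms of cycle multiplicities. -/

section SumOverPairs

theorem minimalPeriod_sym2_diag {α : Type*} [Finite α] (g : Equiv.Perm α) (x : α) :
    minimalPeriod (sym2Perm g) s(x, x) = minimalPeriod g x := by
  have h := minimalPeriod_sym2_iterate g x (minimalPeriod_perm_pos g x)
  rwa [iterate_zero_apply, if_neg (by have := minimalPeriod_perm_pos g x; omega)] at h

variable {α : Type*} [Fintype α] [DecidableEq α]

theorem sum_range_ite_two_mul_eq (w : ℕ → ℝ) {l : ℕ} (hl : 0 < l) :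
    ∑ k ∈ range l, w (if 2 * k = l then k else l) =
      (l - 1) * w l + w (if Even l then l / 2 else l) := by
  rcases Nat.even_or_odd l with h | h
  · obtain ⟨c, hc⟩ := h
    have hmem : c ∈ range l := mem_range.2 (by omega)
    rw [← add_sum_erase _ _ hmem, sum_congr rfl (g := fun _ => w l), sum_const,
      card_erase_of_mem hmem, card_range, if_pos (by omega : 2 * c = l), if_pos ⟨c, hc⟩,
      nsmul_eq_mul, Nat.cast_sub hl, show l / 2 = c by omega]
    · push_cast
      ring
    · intro k hk
      rw [mem_erase] at hk
      rw [if_neg (by omega)]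
  · have h' : ¬ Even l := Nat.not_even_iff_odd.2 h
    obtain ⟨c, hc⟩ := h
    rw [sum_congr rfl (g := fun _ => w l), sum_const, card_range, if_neg h', nsmul_eq_mul]
    · ring
    · intro k hk
      rw [if_neg (by omega)]

theorem sum_sameCycle_sym2 (g : Equiv.Perm α) (x : α) (w : ℕ → ℝ) :
    ∑ y ∈ univ.filter (g.SameCycle x), w (minimalPeriod (sym2Perm g) s(x, y)) =
      (minimalPeriod g x - 1) * w (minimalPeriod g x) +
        w (if Even (minimalPeriod g x) then minimalPeriod g x / 2 else minimalPeriod g x) := by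
  rw [filter_sameCycle_eq_image, sum_image (iterate_injOn_range_minimalPeriod g x),
    ← sum_range_ite_two_mul_eq w (minimalPeriod_perm_pos g x)]
  refine sum_congr rfl fun k hk => ?_
  rw [minimalPeriod_sym2_iterate g x (mem_range.1 hk)]

/-- A sum over the unordered pairs of a function of the period, in terms of the periods of the
points. -/
theorem sum_sym2_minimalPeriod (g : Equiv.Perm α) (w : ℕ → ℝ) :
    ∑ z, w (minimalPeriod (sym2Perm g) z) =
      ((∑ x, ∑ y, w ((minimalPeriod g x).lcm (minimalPeriod g y))) +
        ∑ x, w (if Even (minimalPeriod g x) then minimalPeriod g x / 2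
          else minimalPeriod g x)) / 2 := by
  rw [sum_sym2]
  congr 1
  rw [← sum_add_distrib, ← sum_add_distrib]
  refine sum_congr rfl fun x _ => ?_
  rw [minimalPeriod_sym2_diag, ← sum_filter_add_sum_filter_not univ (g.SameCycle x),
    sum_sameCycle_sym2, ← sum_filter_add_sum_filter_not univ (g.SameCycle x)
      (fun y => w ((minimalPeriod g x).lcm (minimalPeriod g y)))]
  -- Within one cycle of length `l`, the diagonal term completes `(l - 1) * w l` to `l * w l`, which
  -- is the lcm sum over that cycle.
  have h1 : ∑ y ∈ univ.filter (g.SameCycle x),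
      w ((minimalPeriod g x).lcm (minimalPeriod g y)) =
        minimalPeriod g x * w (minimalPeriod g x) := by
    rw [sum_congr rfl (g := fun _ => w (minimalPeriod g x)), sum_const, card_filter_sameCycle,
      nsmul_eq_mul]
    intro y hy
    rw [minimalPeriod_eq_of_sameCycle (mem_filter.1 hy).2, Nat.lcm_self]
  have h2 : ∑ y ∈ univ.filter (fun y => ¬ g.SameCycle x y),
      w (minimalPeriod (sym2Perm g) s(x, y)) =
        ∑ y ∈ univ.filter (fun y => ¬ g.SameCycle x y),
          w ((minimalPeriod g x).lcm (minimalPeriod g y)) :=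
    sum_congr rfl fun y hy => by
      rw [minimalPeriod_sym2_of_not_sameCycle (mem_filter.1 hy).2]
  rw [h1, h2]
  ring

theorem sum_Icc_even_add_odd (n : ℕ) (h : ℕ → ℝ) :
    ∑ l ∈ Icc 1 n, h l =
      ∑ a ∈ Icc 1 (n / 2), h (2 * a) + ∑ a ∈ Icc 1 ((n + 1) / 2), h (2 * a - 1) := by
  induction n with
  | zero => simp
  | succ n ih =>
    rw [sum_Icc_succ_top (by omega), ih]
    rcases Nat.even_or_odd' n with ⟨c, rfl | rfl⟩
    · rw [show (2 * c + 1) / 2 = c by omega, show 2 * c / 2 = c by omega,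
        show (2 * c + 1 + 1) / 2 = c + 1 by omega, sum_Icc_succ_top (by omega : 1 ≤ c + 1),
        show 2 * (c + 1) - 1 = 2 * c + 1 by omega]
      ring
    · rw [show (2 * c + 1) / 2 = c by omega, show (2 * c + 1 + 1) / 2 = c + 1 by omega,
        show (2 * c + 1 + 1 + 1) / 2 = c + 1 by omega, sum_Icc_succ_top (by omega : 1 ≤ c + 1)
          (fun a => h (2 * a)), show 2 * (c + 1) = 2 * c + 1 + 1 by ring]
      ring

theorem sum_Icc_Icc_of_symm (n : ℕ) (f : ℕ → ℕ → ℝ) (hf : ∀ a b, f a b = f b a) :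
    ∑ a ∈ Icc 1 n, ∑ b ∈ Icc 1 n, f a b =
      ∑ a ∈ Icc 1 n, f a a + 2 * ∑ b ∈ Icc 1 n, ∑ a ∈ Ico 1 b, f a b := by
  induction n with
  | zero => simp
  | succ n ih =>
    simp only [sum_Icc_succ_top (show 1 ≤ n + 1 by omega), sum_add_distrib, ih]
    rw [show Ico 1 (n + 1) = Icc 1 n by ext; simp [Order.lt_add_one_iff],
      sum_congr rfl fun b (_ : b ∈ Icc 1 n) => hf (n + 1) b]
    ring

/-- The weight `gcd a b` is `a * b / lcm a b`, the number of cycles on the product of an `a`-cycle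
and a `b`-cycle. An even cycle `2a` adds one orbit of `a` antipodal pairs besides `a` orbits of full
length; an odd cycle `2a - 1` gives `a` orbits of full length. -/
theorem sum_log_sym2 (g : Equiv.Perm α) (φ : ℕ → ℝ) {n : ℕ} (hn : Fintype.card α = n) :
    ∑ z, φ (minimalPeriod (sym2Perm g) z) / minimalPeriod (sym2Perm g) z =
      (∑ a ∈ Icc 1 (n / 2), (mult g.partition (2 * a) * φ a +
          (a * mult g.partition (2 * a) : ℕ) * φ (2 * a))) +
        (∑ a ∈ Icc 1 ((n + 1) / 2), (a * mult g.partition (2 * a - 1) : ℕ) * φ (2 * a - 1)) +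
        (∑ a ∈ Icc 1 n, (a * (mult g.partition a).choose 2 : ℕ) * φ a) +
        ∑ b ∈ Icc 1 n, ∑ a ∈ Ico 1 b,
          (mult g.partition a * mult g.partition b * Nat.gcd a b : ℕ) * φ (Nat.lcm a b) := by
  set k : ℕ → ℕ := mult g.partition with hk
  have hsum : ∀ ψ : ℕ → ℝ, ∑ x, ψ (minimalPeriod g x) = ∑ l ∈ Icc 1 n, (l : ℝ) * k l * ψ l := by
    intro ψ
    rw [sum_minimalPeriod, ← hn]
  rw [sum_sym2_minimalPeriod g (fun m => φ m / m)]
  have h1 : ∑ x, ∑ y, φ ((minimalPeriod g x).lcm (minimalPeriod g y)) /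
      ((minimalPeriod g x).lcm (minimalPeriod g y) : ℕ) =
      ∑ a ∈ Icc 1 n, ∑ b ∈ Icc 1 n, ((k a * k b * Nat.gcd a b : ℕ) : ℝ) * φ (Nat.lcm a b) := by
    have h2 : ∀ x, ∑ y, φ ((minimalPeriod g x).lcm (minimalPeriod g y)) /
        ((minimalPeriod g x).lcm (minimalPeriod g y) : ℕ) = _ := fun x =>
      hsum (fun b => φ ((minimalPeriod g x).lcm b) / ((minimalPeriod g x).lcm b : ℕ))
    rw [sum_congr rfl fun x _ => h2 x, hsum (fun a =>
      ∑ l ∈ Icc 1 n, (l : ℝ) * k l * (φ (a.lcm l) / (a.lcm l : ℕ)))]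
    refine sum_congr rfl fun a ha => ?_
    rw [mul_sum]
    refine sum_congr rfl fun b hb => ?_
    have h3 : (Nat.gcd a b : ℝ) * Nat.lcm a b = a * b := by exact_mod_cast Nat.gcd_mul_lcm a b
    have h4 : (Nat.lcm a b : ℝ) ≠ 0 := by
      exact_mod_cast Nat.lcm_ne_zero (by have := mem_Icc.1 ha; omega)
        (by have := mem_Icc.1 hb; omega)
    push_cast
    field_simp
    linear_combination (-(k a * k b * φ (a.lcm b))) * h3
  have h5 := hsum fun l =>
    φ (if Even l then l / 2 else l) / ((if Even l then l / 2 else l : ℕ) : ℝ)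
  rw [h1, h5, sum_Icc_Icc_of_symm _ _ fun a b => by
    rw [Nat.gcd_comm, Nat.lcm_comm, mul_comm (k a)]]
  -- From `k² = 2 * choose k 2 + k`: pairs of distinct cycles of equal length, and pairs inside one
  -- cycle.
  have h6 : ∑ a ∈ Icc 1 n, ((k a * k a * Nat.gcd a a : ℕ) : ℝ) * φ (Nat.lcm a a) =
      2 * (∑ a ∈ Icc 1 n, (a * (k a).choose 2 : ℕ) * φ a) + ∑ a ∈ Icc 1 n, a * k a * φ a := by
    rw [mul_sum, ← sum_add_distrib]
    refine sum_congr rfl fun a _ => ?_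
    rw [Nat.gcd_self, Nat.lcm_self]
    push_cast
    rw [Nat.cast_choose_two]
    ring
  rw [h6, sum_Icc_even_add_odd n fun a => a * k a * φ a, sum_Icc_even_add_odd n fun l =>
    (l : ℝ) * k l * (φ (if Even l then l / 2 else l) / ((if Even l then l / 2 else l : ℕ) : ℝ))]
  have h7 : ∑ a ∈ Icc 1 (n / 2), ((2 * a : ℕ) : ℝ) * k (2 * a) *
      (φ (if Even (2 * a) then 2 * a / 2 else 2 * a) /
        ((if Even (2 * a) then 2 * a / 2 else 2 * a : ℕ) : ℝ)) =
      2 * ∑ a ∈ Icc 1 (n / 2), k (2 * a) * φ a := by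
    rw [mul_sum]
    refine sum_congr rfl fun a ha => ?_
    have h8 : (a : ℝ) ≠ 0 := by
      have := mem_Icc.1 ha
      exact_mod_cast (by omega : a ≠ 0)
    rw [if_pos (even_two_mul a), Nat.mul_div_cancel_left a two_pos]
    push_cast
    field_simp
  have h9 : ∑ a ∈ Icc 1 (n / 2), ((2 * a : ℕ) : ℝ) * k (2 * a) * φ (2 * a) =
      2 * ∑ a ∈ Icc 1 (n / 2), (a * k (2 * a) : ℕ) * φ (2 * a) := by
    rw [mul_sum]
    refine sum_congr rfl fun a ha => ?_
    push_cast
    ring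
  have h10 : ∑ a ∈ Icc 1 ((n + 1) / 2), ((2 * a - 1 : ℕ) : ℝ) * k (2 * a - 1) * φ (2 * a - 1) +
      ∑ a ∈ Icc 1 ((n + 1) / 2), ((2 * a - 1 : ℕ) : ℝ) * k (2 * a - 1) *
      (φ (if Even (2 * a - 1) then (2 * a - 1) / 2 else 2 * a - 1) /
        ((if Even (2 * a - 1) then (2 * a - 1) / 2 else 2 * a - 1 : ℕ) : ℝ)) =
      2 * ∑ a ∈ Icc 1 ((n + 1) / 2), (a * k (2 * a - 1) : ℕ) * φ (2 * a - 1) := by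
    rw [mul_sum, ← sum_add_distrib]
    refine sum_congr rfl fun a ha => ?_
    have h8 := (mem_Icc.1 ha).1
    have h11 : ¬ Even (2 * a - 1) := by
      rw [Nat.not_even_iff_odd]
      exact ⟨a - 1, by omega⟩
    have h12 : ((2 * a - 1 : ℕ) : ℝ) = 2 * a - 1 := by
      rw [Nat.cast_sub (by omega)]
      push_cast
      ring
    have h13 : ((2 * a - 1 : ℕ) : ℝ) ≠ 0 := by
      exact_mod_cast (by omega : 2 * a - 1 ≠ 0)
    rw [if_neg h11]
    field_simp
    rw [h12]
    push_cast
    ring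
  rw [sum_add_distrib]
  rw [h7, h9]
  linear_combination h10 / 2

end SumOverPairs

/-! ### The summand of `K` and its logarithm. -/

/-- The contribution of a pair of cycle structures to the number of fixed maps: the number of maps
from the unordered pairs to the pointed set that are compatible with permutations of these cycle
structures. -/
def cycleWeight {m n : ℕ} (k : Nat.Partition m) (j : Nat.Partition n) : ℕ :=
  (∏ a ∈ Icc 1 (m / 2),
      fixCount j a ^ mult k (2 * a) * fixCount j (2 * a) ^ (a * mult k (2 * a))) *
    (∏ a ∈ Icc 1 ((m + 1) / 2), fixCount j (2 * a - 1) ^ (a * mult k (2 * a - 1))) *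
    (∏ a ∈ Icc 1 m, fixCount j a ^ (a * (mult k a).choose 2)) *
    (∏ b ∈ Icc 1 m, ∏ a ∈ Ico 1 b,
      fixCount j (Nat.lcm a b) ^ (mult k a * mult k b * Nat.gcd a b))

theorem fixCount_pos {n : ℕ} (j : Nat.Partition n) (i : ℕ) : 0 < fixCount j i := by
  unfold fixCount
  omega

theorem log_cycleWeight {m n : ℕ} (k : Nat.Partition m) (j : Nat.Partition n) :
    cycleWeight k j ≠ 0 ∧ Real.log (cycleWeight k j) =
      (∑ a ∈ Icc 1 (m / 2), (mult k (2 * a) * Real.log (fixCount j a) +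
          (a * mult k (2 * a) : ℕ) * Real.log (fixCount j (2 * a)))) +
        (∑ a ∈ Icc 1 ((m + 1) / 2), (a * mult k (2 * a - 1) : ℕ) *
          Real.log (fixCount j (2 * a - 1))) +
        (∑ a ∈ Icc 1 m, (a * (mult k a).choose 2 : ℕ) * Real.log (fixCount j a)) +
        ∑ b ∈ Icc 1 m, ∑ a ∈ Ico 1 b,
          (mult k a * mult k b * Nat.gcd a b : ℕ) * Real.log (fixCount j (Nat.lcm a b)) := by
  have h0 : ∀ i e, fixCount j i ^ e ≠ 0 := fun i e => pow_ne_zero _ (fixCount_pos j i).ne'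
  have h1 : ∀ i e, (fixCount j i : ℝ) ^ e ≠ 0 := fun i e => by exact_mod_cast h0 i e
  refine ⟨?_, ?_⟩
  · simp only [cycleWeight, ne_eq, mul_eq_zero, prod_eq_zero_iff, h0, or_self, and_false,
      exists_false, not_false_eq_true]
  · unfold cycleWeight
    push_cast
    have e1 : ∏ a ∈ Icc 1 (m / 2), ((fixCount j a : ℝ) ^ mult k (2 * a) *
        (fixCount j (2 * a) : ℝ) ^ (a * mult k (2 * a))) ≠ 0 :=
      prod_ne_zero_iff.2 fun a _ => mul_ne_zero (h1 _ _) (h1 _ _)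
    have e2 : ∏ a ∈ Icc 1 ((m + 1) / 2),
        (fixCount j (2 * a - 1) : ℝ) ^ (a * mult k (2 * a - 1)) ≠ 0 :=
      prod_ne_zero_iff.2 fun a _ => h1 _ _
    have e3 : ∏ a ∈ Icc 1 m, (fixCount j a : ℝ) ^ (a * (mult k a).choose 2) ≠ 0 :=
      prod_ne_zero_iff.2 fun a _ => h1 _ _
    have e4 : ∀ b ∈ Icc 1 m, ∏ a ∈ Ico 1 b,
        (fixCount j (Nat.lcm a b) : ℝ) ^ (mult k a * mult k b * Nat.gcd a b) ≠ 0 :=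
      fun b _ => prod_ne_zero_iff.2 fun a _ => h1 _ _
    rw [Real.log_mul (mul_ne_zero (mul_ne_zero e1 e2) e3) (prod_ne_zero_iff.2 e4),
      Real.log_mul (mul_ne_zero e1 e2) e3, Real.log_mul e1 e2,
      Real.log_prod fun a _ => mul_ne_zero (h1 _ _) (h1 _ _), Real.log_prod fun a _ => h1 _ _,
      Real.log_prod fun a _ => h1 _ _, Real.log_prod e4]
    congr 1
    · congr 1
      · congr 1
        · refine sum_congr rfl fun a _ => ?_
          rw [Real.log_mul (h1 _ _) (h1 _ _), Real.log_pow, Real.log_pow]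
          push_cast
          rfl
        · refine sum_congr rfl fun a _ => ?_
          rw [Real.log_pow]
          push_cast
          rfl
      · refine sum_congr rfl fun a _ => ?_
        rw [Real.log_pow]
        push_cast
        rfl
    · refine sum_congr rfl fun b _ => ?_
      rw [Real.log_prod fun a _ => h1 _ _]
      refine sum_congr rfl fun a _ => ?_
      rw [Real.log_pow]
      push_cast
      rfl

/-! ### Orbits of pair maps and Burnside's lemma. -/

section Burnside

variable {α β : Type*}

variable (α β) in
/-- The maps from the unordered pairs of elements of `α` to `β` with a point added. -/
def PairMap : Type _ := Sym2 α → Option β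

instance : MulAction (Equiv.Perm α × Equiv.Perm β) (PairMap α β) where
  smul g f := fun z => Equiv.optionCongr g.2 (f ((sym2Perm g.1).symm z))
  one_smul f := by
    funext z
    change Equiv.optionCongr (1 : Equiv.Perm β) (f ((sym2Perm (1 : Equiv.Perm α)).symm z)) = f z
    induction z with | _ x y
    change Option.map id (f s(x, y)) = _
    simp
  mul_smul g h f := by
    funext z
    change Equiv.optionCongr (g.2 * h.2) (f ((sym2Perm (g.1 * h.1)).symm z)) =
      Equiv.optionCongr g.2 (Equiv.optionCongr h.2
        (f ((sym2Perm h.1).symm ((sym2Perm g.1).symm z))))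
    induction z with | _ x y
    change Option.map (g.2 ∘ h.2) (f _) = Option.map g.2 (Option.map h.2 (f _))
    rw [Option.map_map]
    rfl

theorem smul_eq_iff (g : Equiv.Perm α × Equiv.Perm β) (f f' : PairMap α β) :
    g • f = f' ↔ ∀ z, f' (sym2Perm g.1 z) = Equiv.optionCongr g.2 (f z) := by
  constructor
  · rintro rfl z
    change Equiv.optionCongr g.2 (f ((sym2Perm g.1).symm (sym2Perm g.1 z))) = _
    rw [Equiv.symm_apply_apply]
  · intro h
    funext z
    change Equiv.optionCongr g.2 (f ((sym2Perm g.1).symm z)) = f' z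
    rw [← h, Equiv.apply_symm_apply]

variable (α β) in
/-- The classes of maps from unordered pairs up to permutations of `α` and of `β`. -/
abbrev PairOrbit : Type _ := MulAction.orbitRel.Quotient (Equiv.Perm α × Equiv.Perm β) (PairMap α β)

theorem pairOrbit_mk_eq_iff (f f' : PairMap α β) :
    (Quotient.mk'' f : PairOrbit α β) = Quotient.mk'' f' ↔
      ∃ (σ : Equiv.Perm α) (τ : Equiv.Perm β),
        ∀ z, f' (sym2Perm σ z) = Equiv.optionCongr τ (f z) := by
  rw [eq_comm, Quotient.eq'', MulAction.orbitRel_apply, MulAction.mem_orbit_iff]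
  constructor
  · rintro ⟨g, hg⟩
    exact ⟨g.1, g.2, (smul_eq_iff g f f').1 hg⟩
  · rintro ⟨σ, τ, h⟩
    exact ⟨(σ, τ), (smul_eq_iff (σ, τ) f f').2 h⟩

variable [Fintype α] [DecidableEq α] [Fintype β] [DecidableEq β]

noncomputable instance : Fintype (PairMap α β) := inferInstanceAs (Fintype (Sym2 α → Option β))

/-- Both sides are positive and have the same logarithm, by `log_card_equivariant` and
`sum_log_sym2` on one side and `log_cycleWeight` on the other. -/
theorem card_equivariant_eq_cycleWeight (σ : Equiv.Perm α) (τ : Equiv.Perm β) :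
    Nat.card {f : Sym2 α → Option β // ∀ z, f (sym2Perm σ z) = Equiv.optionCongr τ (f z)} =
      cycleWeight σ.partition τ.partition := by
  obtain ⟨h1, h2⟩ := log_card_equivariant (sym2Perm σ) (Equiv.optionCongr τ)
    (fixCount τ.partition) (fun m hm => card_filter_iterate_optionCongr τ hm)
    (fun m _ => fixCount_pos _ m)
  obtain ⟨h3, h4⟩ := log_cycleWeight σ.partition τ.partition
  rw [sum_log_sym2 σ (fun m => Real.log (fixCount τ.partition m)) rfl, ← h4] at h2
  have h5 := Real.log_injOn_pos
    (Set.mem_Ioi.2 (by exact_mod_cast Nat.pos_of_ne_zero h1))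
    (Set.mem_Ioi.2 (by exact_mod_cast Nat.pos_of_ne_zero h3)) h2
  exact_mod_cast h5

theorem card_pairOrbit_mul :
    Nat.card (PairOrbit α β) * ((Fintype.card α).factorial * (Fintype.card β).factorial) =
      ∑ σ : Equiv.Perm α, ∑ τ : Equiv.Perm β, cycleWeight σ.partition τ.partition := by
  classical
  have h := MulAction.sum_card_fixedBy_eq_card_orbits_mul_card_group
    (Equiv.Perm α × Equiv.Perm β) (PairMap α β)
  rw [Fintype.card_prod, Fintype.card_perm, Fintype.card_perm, ← Nat.card_eq_fintype_card] at h
  rw [← h, Fintype.sum_prod_type]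
  refine sum_congr rfl fun σ _ => sum_congr rfl fun τ _ => ?_
  rw [← card_equivariant_eq_cycleWeight, ← Nat.card_eq_fintype_card]
  refine Nat.card_congr (Equiv.subtypeEquivRight fun f => ?_)
  exact smul_eq_iff (σ, τ) f f

theorem sum_partition (F : Nat.Partition (Fintype.card α) → ℚ) :
    ∑ σ : Equiv.Perm α, F σ.partition =
      ∑ k, ((Fintype.card α).factorial / symmFactor k : ℚ) * F k := by
  rw [← sum_fiberwise (s := univ) (g := fun σ : Equiv.Perm α => σ.partition)]
  refine sum_congr rfl fun k _ => ?_
  rw [sum_congr rfl (g := fun _ => F k) (fun σ hσ => by rw [(mem_filter.1 hσ).2]), sum_const,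
    nsmul_eq_mul]
  congr 1
  have h := card_partition_eq_mul_symmFactor k
  have h0 : symmFactor k ≠ 0 := by
    intro h0
    rw [h0, mul_zero] at h
    exact (Nat.factorial_ne_zero _) h.symm
  rw [eq_div_iff (by exact_mod_cast h0)]
  exact_mod_cast h

/-- The number of classes of maps from unordered pairs, by Burnside's lemma. -/
theorem sum_cycleWeight_eq_card_pairOrbit {m n : ℕ} (hm : Fintype.card α = m)
    (hn : Fintype.card β = n) :
    ∑ j : Nat.Partition n, ∑ k : Nat.Partition m,
      ((symmFactor j * symmFactor k : ℕ) : ℚ)⁻¹ * (cycleWeight k j : ℚ) =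
        Nat.card (PairOrbit α β) := by
  subst hm hn
  have h : (Nat.card (PairOrbit α β) : ℚ) *
      ((Fintype.card α).factorial * (Fintype.card β).factorial) =
      ∑ σ : Equiv.Perm α, ∑ τ : Equiv.Perm β, (cycleWeight σ.partition τ.partition : ℚ) := by
    exact_mod_cast card_pairOrbit_mul (α := α) (β := β)
  have h1 : ((Fintype.card α).factorial : ℚ) ≠ 0 := by exact_mod_cast Nat.factorial_ne_zero _
  have h2 : ((Fintype.card β).factorial : ℚ) ≠ 0 := by exact_mod_cast Nat.factorial_ne_zero _
  rw [← mul_left_inj' (mul_ne_zero h1 h2), h,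
    sum_congr rfl fun σ (_ : σ ∈ univ) => sum_partition (α := β) fun j =>
      (cycleWeight (Equiv.Perm.partition σ) j : ℚ),
    sum_partition (α := α) fun k =>
      ∑ j, ((Fintype.card β).factorial / symmFactor j : ℚ) * (cycleWeight k j : ℚ),
    sum_comm, sum_mul]
  refine sum_congr rfl fun k _ => ?_
  rw [sum_mul, mul_sum]
  refine sum_congr rfl fun j _ => ?_
  push_cast
  rw [mul_inv]
  ring

end Burnside

theorem K_eq_card_pairOrbit (p q : ℕ) :
    K p q = Nat.card (PairOrbit (Fin (p - q)) (Fin (q - 1))) :=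
  sum_cycleWeight_eq_card_pairOrbit (Fintype.card_fin _) (Fintype.card_fin _)

/-! ### Full maps and the difference of orbit counts. -/

/-- A map from unordered pairs hits every point other than the added one. -/
def IsFull {α β : Type*} (f : PairMap α β) : Prop := ∀ b, ∃ z, f z = some b

/-- The class consists of maps that hit every point other than the added one. -/
def IsFullOrbit {α β : Type*} (q : PairOrbit α β) : Prop :=
  ∃ f : PairMap α β, Quotient.mk'' f = q ∧ IsFull f

theorem isFullOrbit_mk_iff {α β : Type*} (f : PairMap α β) :
    IsFullOrbit (Quotient.mk'' f : PairOrbit α β) ↔ IsFull f := by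
  refine ⟨?_, fun h => ⟨f, rfl, h⟩⟩
  rintro ⟨f', h, hf'⟩ b
  obtain ⟨σ, τ, hστ⟩ := (pairOrbit_mk_eq_iff f' f).1 h
  obtain ⟨z, hz⟩ := hf' (τ.symm b)
  exact ⟨sym2Perm σ z, by rw [hστ, hz]; simp⟩

/-- Two maps to a pointed finite set that have the same kernel differ by a permutation of the
other points. -/
theorem exists_perm_of_kernel_eq {X β : Type*} [Finite β] {f f' : X → Option β}
    (hnone : ∀ x, f x = none ↔ f' x = none) (hker : ∀ x y, f x = f y ↔ f' x = f' y) :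
    ∃ τ : Equiv.Perm β, ∀ x, f' x = Equiv.optionCongr τ (f x) := by
  classical
  have := Fintype.ofFinite β
  have hex : ∀ b, ∃ b', ∀ x, f x = some b → f' x = some b' := by
    intro b
    by_cases h : ∃ x, f x = some b
    · obtain ⟨x, hx⟩ := h
      have h1 : f' x ≠ none := fun h => by simp [(hnone x).2 h] at hx
      obtain ⟨b', hb'⟩ := Option.ne_none_iff_exists'.1 h1
      exact ⟨b', fun y hy => by rw [← hb', (hker y x).1 (hy.trans hx.symm)]⟩
    · exact ⟨b, fun x hx => (h ⟨x, hx⟩).elim⟩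
  choose φ hφ using hex
  -- `φ` is injective on the points hit by `f`; by finiteness it extends from there to a
  -- permutation.
  obtain ⟨e, he⟩ := Set.MapsTo.exists_equiv_extend_of_card_eq (α := β) (t := univ)
    (s := {b | ∃ x, f x = some b}) (f := φ) (by simp) (fun _ _ => by simp) (by
      rintro b ⟨x, hx⟩ c ⟨y, hy⟩ hbc
      have h1 : f' x = f' y := by rw [hφ b x hx, hφ c y hy, hbc]
      have h2 := (hker x y).2 h1
      rw [hx, hy] at h2
      exact Option.some.inj h2)
  refine ⟨e.trans (Equiv.subtypeUnivEquiv fun b => mem_univ b), fun x => ?_⟩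
  cases hx : f x with
  | none => rw [(hnone x).1 hx]; rfl
  | some b =>
    rw [hφ b x hx, ← he b ⟨x, hx⟩]
    rfl

theorem optionCongr_eq_none_iff {β : Type*} (τ : Equiv.Perm β) (y : Option β) :
    Equiv.optionCongr τ y = none ↔ y = none := by
  cases y <;> simp

/-- Enlarging the target of a map by a point that is not hit. -/
def extendTarget {α : Type*} {b : ℕ} (f : PairMap α (Fin b)) : PairMap α (Fin (b + 1)) :=
  fun z => (f z).map Fin.castSucc

theorem extendTarget_apply_eq_iff {α : Type*} {b : ℕ} (f : PairMap α (Fin b)) (y z : Sym2 α) :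
    extendTarget f y = extendTarget f z ↔ f y = f z :=
  (Option.map_injective (Fin.castSucc_injective b)).eq_iff

theorem extendTarget_eq_none_iff {α : Type*} {b : ℕ} (f : PairMap α (Fin b)) (z : Sym2 α) :
    extendTarget f z = none ↔ f z = none := Option.map_eq_none_iff

/-- Up to permuting the target, a map is determined by its kernel and its fibre over `none`, and
neither sees the extra point. -/
theorem pairOrbit_extendTarget_eq_iff {α : Type*} {b : ℕ} (f f' : PairMap α (Fin b)) :
    (Quotient.mk'' (extendTarget f) : PairOrbit α (Fin (b + 1))) = Quotient.mk'' (extendTarget f') ↔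
      (Quotient.mk'' f : PairOrbit α (Fin b)) = Quotient.mk'' f' := by
  rw [pairOrbit_mk_eq_iff, pairOrbit_mk_eq_iff]
  constructor
  · rintro ⟨σ, τ, h⟩
    have h1 : ∀ z, f z = none ↔ f' (sym2Perm σ z) = none := fun z => by
      rw [← extendTarget_eq_none_iff f, ← extendTarget_eq_none_iff f', h, optionCongr_eq_none_iff]
    have h2 : ∀ y z, f y = f z ↔ f' (sym2Perm σ y) = f' (sym2Perm σ z) := fun y z => by
      rw [← extendTarget_apply_eq_iff f, ← extendTarget_apply_eq_iff f', h, h,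
        EmbeddingLike.apply_eq_iff_eq]
    obtain ⟨τ', hτ'⟩ := exists_perm_of_kernel_eq (f := f) (f' := fun z => f' (sym2Perm σ z)) h1 h2
    exact ⟨σ, τ', hτ'⟩
  · rintro ⟨σ, τ, h⟩
    have h1 : ∀ z, extendTarget f z = none ↔ extendTarget f' (sym2Perm σ z) = none := fun z => by
      rw [extendTarget_eq_none_iff, extendTarget_eq_none_iff, h, optionCongr_eq_none_iff]
    have h2 : ∀ y z, extendTarget f y = extendTarget f z ↔
        extendTarget f' (sym2Perm σ y) = extendTarget f' (sym2Perm σ z) := fun y z => by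
      rw [extendTarget_apply_eq_iff f, extendTarget_apply_eq_iff f', h, h,
        EmbeddingLike.apply_eq_iff_eq]
    obtain ⟨τ', hτ'⟩ := exists_perm_of_kernel_eq (f := extendTarget f)
      (f' := fun z => extendTarget f' (sym2Perm σ z)) h1 h2
    exact ⟨σ, τ', hτ'⟩

theorem not_isFull_extendTarget {α : Type*} {b : ℕ} (f : PairMap α (Fin b)) :
    ¬ IsFull (extendTarget f) := by
  intro h
  obtain ⟨z, hz⟩ := h (Fin.last b)
  obtain ⟨i, -, hi⟩ := Option.map_eq_some_iff.1 hz
  exact (Fin.castSucc_lt_last i).ne hi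

theorem exists_extendTarget_of_not_isFull {α : Type*} {b : ℕ} (f : PairMap α (Fin (b + 1)))
    (hf : ¬ IsFull f) : ∃ f' : PairMap α (Fin b),
      (Quotient.mk'' (extendTarget f') : PairOrbit α (Fin (b + 1))) = Quotient.mk'' f := by
  unfold IsFull at hf
  push Not at hf
  obtain ⟨i, hi⟩ := hf
  -- Swapping the missed point `i` with the last one makes the map factor through `Fin.castSucc`.
  have h1 : ∀ z, ∃ y : Option (Fin b),
      Equiv.optionCongr (Equiv.swap i (Fin.last b)) (f z) = y.map Fin.castSucc := by
    intro z
    cases hz : f z with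
    | none => exact ⟨none, rfl⟩
    | some c =>
      have h2 : Equiv.swap i (Fin.last b) c ≠ Fin.last b := by
        intro h
        rw [Equiv.swap_apply_eq_iff, Equiv.swap_apply_right] at h
        exact hi z (by rw [hz, h])
      obtain ⟨d, hd⟩ := Fin.exists_castSucc_eq.2 h2
      exact ⟨some d, by rw [Equiv.optionCongr_apply, Option.map_some, Option.map_some, hd]⟩
  choose f' hf' using h1
  refine ⟨f', Eq.symm ((pairOrbit_mk_eq_iff _ _).2 ⟨1, Equiv.swap i (Fin.last b), fun z => ?_⟩)⟩
  rw [hf']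
  induction z with | _ x y
  rfl

instance finite_pairMap {α β : Type*} [Finite α] [Finite β] : Finite (PairMap α β) :=
  inferInstanceAs (Finite (Sym2 α → Option β))

theorem card_isFullOrbit_add {α : Type*} [Finite α] (b : ℕ) :
    Nat.card {q : PairOrbit α (Fin (b + 1)) // IsFullOrbit q} + Nat.card (PairOrbit α (Fin b)) =
      Nat.card (PairOrbit α (Fin (b + 1))) := by
  classical
  have h1 : Nat.card (PairOrbit α (Fin b)) =
      Nat.card {q : PairOrbit α (Fin (b + 1)) // ¬ IsFullOrbit q} := by
    let F : PairOrbit α (Fin b) → {q : PairOrbit α (Fin (b + 1)) // ¬ IsFullOrbit q} := fun q =>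
      Quotient.liftOn' q (fun f => ⟨Quotient.mk'' (extendTarget f), by
        rw [isFullOrbit_mk_iff]
        exact not_isFull_extendTarget f⟩)
        fun f f' h => Subtype.ext ((pairOrbit_extendTarget_eq_iff f f').2 (Quotient.sound' h))
    refine Nat.card_eq_of_bijective F ⟨?_, ?_⟩
    · intro q q'
      induction q using Quotient.inductionOn' with | _ f
      induction q' using Quotient.inductionOn' with | _ f'
      intro h
      exact (pairOrbit_extendTarget_eq_iff f f').1 (Subtype.ext_iff.1 h)
    · rintro ⟨q, hq⟩
      induction q using Quotient.inductionOn' with | _ f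
      rw [isFullOrbit_mk_iff] at hq
      obtain ⟨f', hf'⟩ := exists_extendTarget_of_not_isFull f hq
      exact ⟨Quotient.mk'' f', Subtype.ext hf'⟩
  rw [h1, ← Nat.card_sum]
  exact Nat.card_congr (Equiv.sumCompl _)

theorem le_choose_of_isFull {α : Type*} [Finite α] {b : ℕ} {f : PairMap α (Fin b)}
    (hf : IsFull f) : b ≤ (Nat.card α + 1).choose 2 := by
  choose g hg using hf
  have hinj : Injective g := fun x y h => Option.some.inj (by rw [← hg x, ← hg y, h])
  have := Nat.card_le_card_of_injective g hinj
  rwa [Nat.card_fin, Sym2.natCard] at this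

/-! ### Semigroups of degree 3 and their models. -/

theorem isNilpotentOfDegree_three_iff (A : Type*) [Semigroup A] :
    IsNilpotentOfDegree A 3 ↔ ∃ z : A, (∀ x y w : A, x * y * w = z) ∧ ∃ x y : A, x * y ≠ z := by
  have h2 : ∀ w, w ∈ powerSet A 2 ↔ ∃ x y : A, w = x * y := by
    intro w
    simp [powerSet]
  have h3 : ∀ w, w ∈ powerSet A 3 ↔ ∃ x y v : A, w = x * y * v := by
    intro w
    simp only [powerSet, Set.mem_ofPred_eq, Set.mem_univ, true_and]
    constructor
    · rintro ⟨_, ⟨x, y, rfl⟩, v, rfl⟩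
      exact ⟨x, y, v, rfl⟩
    · rintro ⟨x, y, v, rfl⟩
      exact ⟨_, ⟨x, y, rfl⟩, v, rfl⟩
  constructor
  · rintro ⟨⟨-, h⟩, hmin⟩
    obtain ⟨z, hz⟩ := Set.ncard_eq_one.1 h
    have hz' : ∀ x y w : A, x * y * w = z := fun x y w => by
      have : x * y * w ∈ powerSet A 3 := (h3 _).2 ⟨x, y, w, rfl⟩
      rwa [hz] at this
    refine ⟨z, hz', ?_⟩
    by_contra! hcon
    have : powerSet A 2 = {z} := by
      ext w
      rw [h2, Set.mem_singleton_iff]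
      refine ⟨?_, fun hw => ⟨z, z, by rw [hcon, hw]⟩⟩
      rintro ⟨x, y, rfl⟩
      exact hcon x y
    have h4 := hmin (a := 2) ⟨by norm_num, by rw [this, Set.ncard_singleton]⟩
    omega
  · rintro ⟨z, hz, x, y, hxy⟩
    refine ⟨⟨by norm_num, ?_⟩, ?_⟩
    · rw [Set.ncard_eq_one]
      refine ⟨z, ?_⟩
      ext w
      rw [h3, Set.mem_singleton_iff]
      refine ⟨?_, fun hw => ⟨z, z, z, by rw [hz, hw]⟩⟩
      rintro ⟨x, y, v, rfl⟩
      exact hz x y v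
    · rintro t ⟨ht, hcard⟩
      by_contra! hlt
      obtain ⟨w, hw⟩ := Set.ncard_eq_one.1 hcard
      -- Both lower powers contain the two distinct elements `z` and `x * y`.
      have h4 : z ∈ powerSet A t ∧ x * y ∈ powerSet A t := by
        obtain rfl | rfl : t = 1 ∨ t = 2 := by omega
        · exact ⟨trivial, trivial⟩
        · exact ⟨(h2 _).2 ⟨z * z, z, (hz z z z).symm⟩, (h2 _).2 ⟨x, y, rfl⟩⟩
      rw [hw, Set.mem_singleton_iff, Set.mem_singleton_iff] at h4
      exact hxy (h4.2.trans h4.1.symm)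

section Model

variable {a b : ℕ}

/-- The multiplication on generators and a pointed set that is given by a map from the unordered
pairs of generators to the pointed set. -/
def modelMul (f : PairMap (Fin a) (Fin b)) :
    Fin a ⊕ Option (Fin b) → Fin a ⊕ Option (Fin b) → Fin a ⊕ Option (Fin b)
  | Sum.inl x, Sum.inl y => Sum.inr (f s(x, y))
  | _, _ => Sum.inr none

@[simp]
theorem modelMul_inl_inl (f : PairMap (Fin a) (Fin b)) (x y : Fin a) :
    modelMul f (Sum.inl x) (Sum.inl y) = Sum.inr (f s(x, y)) := rfl

@[simp]
theorem modelMul_inr_left (f : PairMap (Fin a) (Fin b)) (x : Option (Fin b))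
    (y : Fin a ⊕ Option (Fin b)) : modelMul f (Sum.inr x) y = Sum.inr none := rfl

@[simp]
theorem modelMul_inr_right (f : PairMap (Fin a) (Fin b)) (x : Fin a ⊕ Option (Fin b))
    (y : Option (Fin b)) : modelMul f x (Sum.inr y) = Sum.inr none := by
  cases x <;> rfl

theorem modelMul_comm (f : PairMap (Fin a) (Fin b)) (x y : Fin a ⊕ Option (Fin b)) :
    modelMul f x y = modelMul f y x := by
  rcases x with x | x <;> rcases y with y | y <;> simp [Sym2.eq_swap]

theorem exists_modelMul_eq_inr (f : PairMap (Fin a) (Fin b)) (x y : Fin a ⊕ Option (Fin b)) :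
    ∃ w, modelMul f x y = Sum.inr w := by
  rcases x with x | x <;> rcases y with y | y <;> simp

theorem modelMul_modelMul_left (f : PairMap (Fin a) (Fin b)) (x y w : Fin a ⊕ Option (Fin b)) :
    modelMul f (modelMul f x y) w = Sum.inr none := by
  obtain ⟨v, hv⟩ := exists_modelMul_eq_inr f x y
  rw [hv, modelMul_inr_left]

theorem exists_modelMul_eq_iff {f : PairMap (Fin a) (Fin b)} (hf : IsFull f)
    (w : Fin a ⊕ Option (Fin b)) :
    (∃ x y, modelMul f x y = w) ↔ w ∈ Set.range Sum.inr := by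
  constructor
  · rintro ⟨x, y, rfl⟩
    obtain ⟨v, hv⟩ := exists_modelMul_eq_inr f x y
    exact ⟨v, hv.symm⟩
  · rintro ⟨v | v, rfl⟩
    · exact ⟨Sum.inr none, Sum.inr none, rfl⟩
    · obtain ⟨z, hz⟩ := hf v
      induction z with | _ x y
      exact ⟨Sum.inl x, Sum.inl y, by rw [modelMul_inl_inl, hz]⟩

/-- By fullness the right summand is precisely the set of products, so an isomorphism preserves it
and splits as a permutation of each summand. The one on the right fixes `none`, the product of
`none` with itself. -/
theorem exists_perm_of_modelMul_iso {f f' : PairMap (Fin a) (Fin b)} (hf : IsFull f)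
    (hf' : IsFull f') (e : Equiv.Perm (Fin a ⊕ Option (Fin b)))
    (he : ∀ x y, e (modelMul f x y) = modelMul f' (e x) (e y)) :
    (Quotient.mk'' f : PairOrbit (Fin a) (Fin b)) = Quotient.mk'' f' := by
  have hinr : ∀ w, e w ∈ Set.range Sum.inr ↔ w ∈ Set.range Sum.inr := by
    intro w
    rw [← exists_modelMul_eq_iff hf', ← exists_modelMul_eq_iff hf]
    constructor
    · rintro ⟨x, y, h⟩
      refine ⟨e.symm x, e.symm y, e.injective ?_⟩
      rw [he, Equiv.apply_symm_apply, Equiv.apply_symm_apply, h]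
    · rintro ⟨x, y, h⟩
      exact ⟨e x, e y, by rw [← he, h]⟩
  have hinl : Set.MapsTo e (Set.range Sum.inl) (Set.range Sum.inl) := by
    rintro _ ⟨x, rfl⟩
    rcases hx : e (Sum.inl x) with y | y
    · exact ⟨y, rfl⟩
    · obtain ⟨v, hv⟩ := (hinr (Sum.inl x)).1 ⟨y, hx.symm⟩
      cases hv
  obtain ⟨⟨σ, τ⟩, rfl⟩ := Equiv.Perm.mem_sumCongrHom_range_of_perm_mapsTo_inl hinl
  have hnone : τ none = none := by
    have := he (Sum.inr none) (Sum.inr none)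
    simpa [Equiv.Perm.sumCongrHom] using this
  have hmap : ∀ z, f' (sym2Perm σ z) = τ (f z) := by
    intro z
    induction z with | _ x y
    have := he (Sum.inl x) (Sum.inl y)
    simpa [Equiv.Perm.sumCongrHom, eq_comm] using this
  rw [pairOrbit_mk_eq_iff]
  obtain ⟨τ', hτ'⟩ := exists_perm_of_kernel_eq (f := f) (f' := fun z => f' (sym2Perm σ z))
    (fun z => by rw [hmap, ← τ.injective.eq_iff, hnone])
    (fun y z => by rw [hmap, hmap, τ.injective.eq_iff])
  exact ⟨σ, τ', hτ'⟩

theorem exists_modelMul_iso_of_pairOrbit_eq {f f' : PairMap (Fin a) (Fin b)}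
    (h : (Quotient.mk'' f : PairOrbit (Fin a) (Fin b)) = Quotient.mk'' f') :
    ∃ e : Equiv.Perm (Fin a ⊕ Option (Fin b)),
      ∀ x y, e (modelMul f x y) = modelMul f' (e x) (e y) := by
  obtain ⟨σ, τ, h⟩ := (pairOrbit_mk_eq_iff f f').1 h
  refine ⟨Equiv.sumCongr σ (Equiv.optionCongr τ), fun x y => ?_⟩
  rcases x with x | x <;> rcases y with y | y
  · have := h s(x, y)
    rw [sym2Perm_mk] at this
    simp [this]
  all_goals simp

end Model

/-! ### Isomorphism classes sorted by the number of products. -/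

section Semigroups

variable {n a b : ℕ}

/-- The semigroup is isomorphic to the one given by a map from unordered pairs. -/
def IsModel (S : CommNil3 n) (f : PairMap (Fin a) (Fin b)) : Prop :=
  ∃ e : Fin n ≃ Fin a ⊕ Option (Fin b), ∀ x y, e (S.1.mul x y) = modelMul f (e x) (e y)

theorem exists_zero (S : CommNil3 n) :
    ∃ z, (∀ x y w, S.1.mul (S.1.mul x y) w = z) ∧ ∃ x y, S.1.mul x y ≠ z :=
  (@isNilpotentOfDegree_three_iff (Fin n) S.1.toSemigroup).1 S.2

theorem mul_comm_commNil3 (S : CommNil3 n) (x y : Fin n) : S.1.mul x y = S.1.mul y x :=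
  S.1.mul_comm x y

/-- The set of products of two elements. -/
def squares (S : CommNil3 n) : Set (Fin n) := {w | ∃ x y, S.1.mul x y = w}

theorem ncard_squares_eq_of_iso {S T : CommNil3 n} (h : (isoSetoid n).r S T) :
    (squares S).ncard = (squares T).ncard := by
  obtain ⟨f, hf⟩ := h
  rw [← Set.ncard_image_of_injective (squares S) f.injective]
  congr 1
  ext w
  constructor
  · rintro ⟨_, ⟨x, y, rfl⟩, rfl⟩
    exact ⟨f x, f y, (hf x y).symm⟩
  · rintro ⟨x, y, rfl⟩
    exact ⟨_, ⟨f.symm x, f.symm y, rfl⟩, by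
      rw [hf, Equiv.apply_symm_apply, Equiv.apply_symm_apply]⟩

/-- The number of products of two elements, for an isomorphism class. -/
noncomputable def squareCard (q : Quotient (isoSetoid n)) : ℕ :=
  Quotient.lift (fun S => (squares S).ncard) (fun _ _ h => ncard_squares_eq_of_iso h) q

theorem ncard_squares_of_isModel {S : CommNil3 n} {f : PairMap (Fin a) (Fin b)} (hf : IsFull f)
    (h : IsModel S f) : (squares S).ncard = b + 1 := by
  obtain ⟨e, he⟩ := h
  rw [← Set.ncard_image_of_injective (squares S) e.injective]
  have : e '' squares S = Set.range Sum.inr := by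
    ext w
    rw [← exists_modelMul_eq_iff hf]
    constructor
    · rintro ⟨_, ⟨x, y, rfl⟩, rfl⟩
      exact ⟨e x, e y, (he x y).symm⟩
    · rintro ⟨x, y, rfl⟩
      exact ⟨_, ⟨e.symm x, e.symm y, rfl⟩, by
        rw [he, Equiv.apply_symm_apply, Equiv.apply_symm_apply]⟩
  rw [this, ← Set.image_univ, Set.ncard_image_of_injective _ Sum.inr_injective, Set.ncard_univ]
  simp

theorem iso_iff_pairOrbit_eq {S S' : CommNil3 n} {f f' : PairMap (Fin a) (Fin b)} (hf : IsFull f)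
    (hf' : IsFull f') (h : IsModel S f) (h' : IsModel S' f') :
    (isoSetoid n).r S S' ↔ (Quotient.mk'' f : PairOrbit (Fin a) (Fin b)) = Quotient.mk'' f' := by
  obtain ⟨e, he⟩ := h
  obtain ⟨e', he'⟩ := h'
  have hs : ∀ x y, S.1.mul (e.symm x) (e.symm y) = e.symm (modelMul f x y) := fun x y => by
    rw [Equiv.eq_symm_apply, he, Equiv.apply_symm_apply, Equiv.apply_symm_apply]
  have hs' : ∀ x y, S'.1.mul (e'.symm x) (e'.symm y) = e'.symm (modelMul f' x y) := fun x y => by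
    rw [Equiv.eq_symm_apply, he', Equiv.apply_symm_apply, Equiv.apply_symm_apply]
  constructor
  · rintro ⟨g, hg⟩
    refine exists_perm_of_modelMul_iso hf hf' (e.symm.trans (g.trans e')) fun x y => ?_
    simp only [Equiv.trans_apply]
    rw [← he', ← hg, hs]
  · intro h
    obtain ⟨g, hg⟩ := exists_modelMul_iso_of_pairOrbit_eq h
    refine ⟨e.trans (g.trans e'.symm), fun x y => ?_⟩
    simp only [Equiv.trans_apply]
    rw [hs', ← hg, he]

theorem exists_isModel_of_isFull (hn : a + (b + 1) = n) (hb : 0 < b)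
    {f : PairMap (Fin a) (Fin b)} (hf : IsFull f) : ∃ S : CommNil3 n, IsModel S f := by
  let e : Fin n ≃ Fin a ⊕ Option (Fin b) := Fintype.equivOfCardEq (by simp [hn])
  let S : CommSemigroup (Fin n) :=
    { mul := fun x y => e.symm (modelMul f (e x) (e y))
      mul_assoc := fun x y w => by
        change e.symm (modelMul f (e (e.symm (modelMul f (e x) (e y)))) (e w)) =
          e.symm (modelMul f (e x) (e (e.symm (modelMul f (e y) (e w)))))
        rw [Equiv.apply_symm_apply, Equiv.apply_symm_apply, modelMul_modelMul_left,
          modelMul_comm f (e x), modelMul_modelMul_left]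
      mul_comm := fun x y => by
        change e.symm (modelMul f (e x) (e y)) = e.symm (modelMul f (e y) (e x))
        rw [modelMul_comm] }
  have hmul : ∀ x y : Fin n, e (S.mul x y) = modelMul f (e x) (e y) := fun x y =>
    e.apply_symm_apply _
  refine ⟨⟨S, ?_⟩, e, hmul⟩
  rw [isNilpotentOfDegree_three_iff]
  refine ⟨e.symm (Sum.inr none), fun x y w => ?_, ?_⟩
  · rw [Equiv.eq_symm_apply]
    change e (S.mul (S.mul x y) w) = _
    rw [hmul, hmul, modelMul_modelMul_left]
  -- Here `0 < b` supplies a nonzero product, without which the degree would be below 3.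
  · obtain ⟨x, y, hxy⟩ :=
      (exists_modelMul_eq_iff hf (Sum.inr (some ⟨0, hb⟩))).2 ⟨_, rfl⟩
    refine ⟨e.symm x, e.symm y, fun h => ?_⟩
    rw [Equiv.eq_symm_apply] at h
    change e (S.mul _ _) = _ at h
    rw [hmul, Equiv.apply_symm_apply, Equiv.apply_symm_apply, hxy] at h
    simp at h

theorem exists_isFull_isModel (hn : a + (b + 1) = n) (S : CommNil3 n)
    (hS : (squares S).ncard = b + 1) :
    ∃ f : PairMap (Fin a) (Fin b), IsFull f ∧ IsModel S f := by
  classical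
  obtain ⟨z, hz, -⟩ := exists_zero S
  set P := squares S with hP
  have hmem : ∀ x y : Fin n, S.1.mul x y ∈ P := fun x y => ⟨x, y, rfl⟩
  have hzP : z ∈ P := by
    rw [← hz z z z]
    exact hmem _ _
  have hleft : ∀ x ∈ P, ∀ y, S.1.mul x y = z := by
    rintro _ ⟨u, v, rfl⟩ y
    exact hz u v y
  have hright : ∀ x ∈ P, ∀ y, S.1.mul y x = z := fun x hx y => by rw [mul_comm_commNil3, hleft x hx]
  have hcP : Fintype.card {x // x ∈ P} = b + 1 := by
    rw [← hS, ← Nat.card_eq_fintype_card]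
    rfl
  have hcN : Fintype.card {x // x ∉ P} = a := by
    rw [Fintype.card_subtype_compl, hcP, Fintype.card_fin]
    omega
  let e₁ : {x // x ∉ P} ≃ Fin a := Fintype.equivOfCardEq (by simp [hcN])
  let e₀ : {x // x ∈ P} ≃ Option (Fin b) := Fintype.equivOfCardEq (by simp [hcP])
  -- The swap normalises the labelling so that the zero `z` becomes `none`.
  let e₂ : {x // x ∈ P} ≃ Option (Fin b) := e₀.trans (Equiv.swap (e₀ ⟨z, hzP⟩) none)
  have he₂ : e₂ ⟨z, hzP⟩ = none := by simp [e₂]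
  let e : Fin n ≃ Fin a ⊕ Option (Fin b) :=
    (Equiv.sumCompl (· ∈ P)).symm.trans ((Equiv.sumComm _ _).trans (Equiv.sumCongr e₁ e₂))
  have heP : ∀ x (hx : x ∈ P), e x = Sum.inr (e₂ ⟨x, hx⟩) := fun x hx => by
    simp [e, Equiv.sumCompl_symm_apply_of_pos hx]
  have heN : ∀ x (hx : x ∉ P), e x = Sum.inl (e₁ ⟨x, hx⟩) := fun x hx => by
    simp [e, Equiv.sumCompl_symm_apply_of_neg hx]
  let f : PairMap (Fin a) (Fin b) := Sym2.lift
    ⟨fun x y => e₂ ⟨S.1.mul (e₁.symm x).1 (e₁.symm y).1, hmem _ _⟩, fun x y => by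
      simp only [mul_comm_commNil3 S (e₁.symm x).1]⟩
  have hf : ∀ x y, f s(x, y) = e₂ ⟨S.1.mul (e₁.symm x).1 (e₁.symm y).1, hmem _ _⟩ := fun _ _ => rfl
  refine ⟨f, fun i => ?_, e, fun x y => ?_⟩
  · obtain ⟨⟨w, hw⟩, hwi⟩ := e₂.surjective (some i)
    have hwz : w ≠ z := by
      rintro rfl
      rw [he₂] at hwi
      cases hwi
    obtain ⟨x, y, hxy⟩ := id hw
    change S.1.mul x y = w at hxy
    -- A factor in `P` would make the product zero, so nonzero products come from generators.
    have hx : x ∉ P := fun h => hwz (by rw [← hxy, hleft x h])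
    have hy : y ∉ P := fun h => hwz (by rw [← hxy, hright y h])
    refine ⟨s(e₁ ⟨x, hx⟩, e₁ ⟨y, hy⟩), ?_⟩
    rw [hf, ← hwi]
    congr 1
    simp [hxy]
  · by_cases hx : x ∈ P
    · rw [heP x hx, modelMul_inr_left, hleft x hx, heP z hzP, he₂]
    · by_cases hy : y ∈ P
      · rw [heP y hy, modelMul_inr_right, hright y hy, heP z hzP, he₂]
      · rw [heN x hx, heN y hy, modelMul_inl_inl, hf, heP _ (hmem x y)]
        simp

theorem card_squareCard_eq (hn : a + (b + 1) = n) (hb : 0 < b) :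
    Nat.card {q : Quotient (isoSetoid n) // squareCard q = b + 1} =
      Nat.card {q : PairOrbit (Fin a) (Fin b) // IsFullOrbit q} := by
  have h1 : ∀ q : {q : Quotient (isoSetoid n) // squareCard q = b + 1},
      ∃ (S : CommNil3 n) (f : PairMap (Fin a) (Fin b)),
        Quotient.mk (isoSetoid n) S = q.1 ∧ IsFull f ∧ IsModel S f := by
    rintro ⟨q, hq⟩
    induction q using Quotient.inductionOn with | _ S
    obtain ⟨f, hf, hSf⟩ := exists_isFull_isModel hn S hq
    exact ⟨S, f, rfl, hf, hSf⟩
  choose S f hq hf hSf using h1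
  refine Nat.card_eq_of_bijective (fun q => ⟨Quotient.mk'' (f q), f q, rfl, hf q⟩) ⟨?_, ?_⟩
  · intro q q' h
    have h2 := (iso_iff_pairOrbit_eq (hf q) (hf q') (hSf q) (hSf q')).2 (Subtype.ext_iff.1 h)
    refine Subtype.ext ?_
    rw [← hq, ← hq]
    exact Quotient.sound h2
  · rintro ⟨_, f', rfl, hf'⟩
    obtain ⟨S', hS'⟩ := exists_isModel_of_isFull hn hb hf'
    let q' : {q : Quotient (isoSetoid n) // squareCard q = b + 1} :=
      ⟨Quotient.mk (isoSetoid n) S', ncard_squares_of_isModel hf' hS'⟩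
    refine ⟨q', Subtype.ext ?_⟩
    exact (iso_iff_pairOrbit_eq (hf q') hf' (hSf q') hS').1 (Quotient.exact (hq q'))

theorem squareCard_mem_Icc (q : Quotient (isoSetoid n)) : squareCard q ∈ Icc 2 n := by
  induction q using Quotient.inductionOn with | _ S
  change (squares S).ncard ∈ Icc 2 n
  obtain ⟨z, hz, x, y, hxy⟩ := exists_zero S
  rw [mem_Icc]
  constructor
  · rw [← Set.ncard_pair hxy]
    refine Set.ncard_le_ncard ?_ (Set.toFinite _)
    rintro w (rfl | rfl)
    · exact ⟨x, y, rfl⟩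
    · exact ⟨S.1.mul w w, w, hz w w w⟩
  · exact (Set.ncard_le_card _).trans_eq (Nat.card_fin n)

instance : Finite (CommNil3 n) := by
  refine Finite.of_injective (fun S : CommNil3 n => S.1.mul) fun S T h => Subtype.ext ?_
  exact CommSemigroup.ext h

theorem numCommNil3_eq_sum (n : ℕ) :
    numCommNil3 n = ∑ m ∈ Icc 2 n, Nat.card {q : Quotient (isoSetoid n) // squareCard q = m} := by
  classical
  have := Fintype.ofFinite (Quotient (isoSetoid n))
  rw [numCommNil3, Nat.card_eq_fintype_card, ← card_univ,
    card_eq_sum_card_fiberwise (f := squareCard) (t := Icc 2 n)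
      fun q _ => by exact_mod_cast squareCard_mem_Icc q]
  refine sum_congr rfl fun m _ => ?_
  rw [Nat.card_eq_fintype_card, Fintype.card_subtype]

end Semigroups

/-! ### The summands as counts, and the range of summation. -/

theorem K_sub_K {n m : ℕ} (hm : m ∈ Icc 2 n) :
    K n m - K (n - 1) (m - 1) =
      Nat.card {q : Quotient (isoSetoid n) // squareCard q = m} := by
  obtain ⟨h2, hn⟩ := mem_Icc.1 hm
  obtain ⟨b, rfl⟩ : ∃ b, m = b + 1 + 1 := ⟨m - 2, by omega⟩
  rw [card_squareCard_eq (a := n - (b + 1 + 1)) (by omega) (by omega), K_eq_card_pairOrbit,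
    K_eq_card_pairOrbit, show n - 1 - (b + 1 + 1 - 1) = n - (b + 1 + 1) by omega,
    show b + 1 + 1 - 1 = b + 1 by omega, show b + 1 - 1 = b by omega, ← card_isFullOrbit_add]
  push_cast
  ring

/-- With `a = n - m` and `b = m - 1` the condition is `√(2n + 1/4) ≤ a + 3/2`; squaring leaves `2b ≤
a(a + 1)`. -/
theorem le_c_iff {n m : ℕ} (hm : 0 < m) (hmn : m ≤ n) :
    m ≤ c n ↔ 2 * (m - 1) ≤ (n - m) * (n - m + 1) := by
  obtain ⟨b, rfl⟩ : ∃ b, m = b + 1 := ⟨m - 1, by omega⟩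
  obtain ⟨a, rfl⟩ : ∃ a, n = a + (b + 1) := ⟨n - (b + 1), by omega⟩
  rw [c, Nat.le_floor_iff' hm.ne', add_tsub_cancel_right, add_tsub_cancel_right]
  have h1 : ((b + 1 : ℕ) : ℝ) ≤ ((a + (b + 1) : ℕ) : ℝ) + 3 / 2 -
      Real.sqrt (2 * ((a + (b + 1) : ℕ) : ℝ) + 1 / 4) ↔
      Real.sqrt (2 * ((a + (b + 1) : ℕ) : ℝ) + 1 / 4) ≤ a + 3 / 2 := by
    push_cast
    constructor <;> intro h <;> linarith
  rw [h1, Real.sqrt_le_left (by positivity)]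
  have h2 : (2 * b ≤ a * (a + 1)) ↔ (2 * b : ℝ) ≤ a * (a + 1) := by exact_mod_cast Iff.rfl
  rw [h2]
  push_cast
  constructor <;> intro h <;> nlinarith

theorem card_squareCard_eq_zero {n m : ℕ} (hm : m ∈ Icc 2 n) (h : c n < m) :
    Nat.card {q : Quotient (isoSetoid n) // squareCard q = m} = 0 := by
  obtain ⟨h2, hn⟩ := mem_Icc.1 hm
  rw [← not_le, le_c_iff (by omega) hn, not_le] at h
  obtain ⟨b, rfl⟩ : ∃ b, m = b + 1 := ⟨m - 1, by omega⟩
  rw [card_squareCard_eq (a := n - (b + 1)) (by omega) (by omega)]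
  have : IsEmpty {q : PairOrbit (Fin (n - (b + 1))) (Fin b) // IsFullOrbit q} := by
    refine ⟨?_⟩
    rintro ⟨_, f, -, hf⟩
    have h3 := le_choose_of_isFull hf
    rw [Nat.card_fin, Nat.choose_two_right, Nat.le_div_iff_mul_le two_pos,
      add_tsub_cancel_right] at h3
    rw [add_tsub_cancel_right] at h
    linarith [mul_comm (n - (b + 1)) (n - (b + 1) + 1)]
  exact Nat.card_of_isEmpty

theorem c_le_of_one_le {n : ℕ} (hn : 1 ≤ n) : c n ≤ n := by
  have h1 : (3 / 2 : ℝ) ≤ Real.sqrt (2 * (n : ℝ) + 1 / 4) := by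
    refine Real.le_sqrt_of_sq_le ?_
    have : (1 : ℝ) ≤ n := by exact_mod_cast hn
    linarith
  exact Nat.floor_le_of_le (by linarith)

theorem Icc_c_subset (n : ℕ) : Icc 2 (c n) ⊆ Icc 2 n := by
  rcases Nat.eq_zero_or_pos n with rfl | hn
  -- `c 0 = 1` exceeds 0, but the interval starting at 2 is still empty.
  · have h1 : c 0 < 2 := by
      rw [c, Nat.floor_lt' two_ne_zero]
      have := Real.sqrt_nonneg (2 * ((0 : ℕ) : ℝ) + 1 / 4)
      push_cast at this ⊢
      linarith
    rw [Finset.Icc_eq_empty (by omega)]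
    exact empty_subset _
  · exact Icc_subset_Icc_right (c_le_of_one_le hn)

end CommNilpotentCount

theorem theorem2p5 (n : ℕ) :
    (CommNilpotentCount.numCommNil3 n : ℚ) =
      ∑ m ∈ Finset.Icc 2 (CommNilpotentCount.c n),
        (CommNilpotentCount.K n m - CommNilpotentCount.K (n - 1) (m - 1)) := by
  rw [CommNilpotentCount.numCommNil3_eq_sum,
    ← Finset.sum_subset (CommNilpotentCount.Icc_c_subset n), Nat.cast_sum]
  · exact Finset.sum_congr rfl fun m hm =>
      (CommNilpotentCount.K_sub_K (CommNilpotentCount.Icc_c_subset n hm)).symm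
  · intro m hm hm'
    refine CommNilpotentCount.card_squareCard_eq_zero hm ?_
    rw [Finset.mem_Icc] at hm hm'
    omega
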